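/- Let $(T,\Sigma,\mu)$ be a finite measure space of agents, $(\Omega,\mathscr F)$ a measurable space of states, and $\ell\in\mathbb N$. Let $a:T\times\Omega\to\mathbb R^\ell_+$ be the endowments and $U:T\times\Omega\times\mathbb R^\ell_+\to\mathbb R$ the utilities. Assume: (A1) $a$ is jointly measurable and, for every $\omega\in\Omega$, $a(\cdot,\omega)$ is $\mu$-integrable and every coordinate of $\int_T a(\cdot,\omega)\,d\mu$ is strictly positive; (A2) $U(\cdot,\cdot,x)$ is jointly measurable for every $x\in\mathbb R^\ell_+$, and $U(t,\omega,\cdot)$ is continuous on $\mathbb R^\ell_+$ for every $(t,\omega)$; (A3) $U(t,\omega,x+y)>U(t,\omega,x)$ for all $(t,\omega)$ and all $x,y\in\mathbb R^\ell_+$ with $y\neq 0$. Let $\Delta=\{p\in\mathbb R^\ell: p^h>0 \text{ for all } h,\ \sum_{h=1}^\ell p^h=1\}$. For $(t,\omega,p)\in T\times\Omega\times\Delta$ put $$B(t,\omega,p)=\{x\in\mathbb R^\ell_+:\langle p,x\rangle\le\langle p,a(t,\omega)\rangle\},\qquad \gamma(t,\omega,p)=\frac{1}{\min_h p^h}\sum_{h=1}^\ell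 a^h(t,\omega),$$ $$X(t,\omega,p)=\{x\in\mathbb R^\ell_+: x^h\le\gamma(t,\omega,p)\text{ for all }h\},$$ $$C(t,\omega,p)=\{y\in\mathbb R^\ell_+:U(t,\omega,y)\ge U(t,\omega,x)\text{ for all }x\in B(t,\omega,p)\},\qquad C^X(t,\omega,p)=C(t,\omega,p)\cap X(t,\omega,p).$$ Let $\int_T C^X(\cdot,\omega,p)\,d\mu$ be the Aumann integral, i.e. the set of all $\int_T f\,d\mu$, where $f:T\to\mathbb R^\ell$ is $\mu$-integrable and $f(t)\in C^X(t,\omega,p)$ for $\mu$-almost every $t$. Then for every $\omega\in\Omega$ the correspondence $p\mapsto\int_T C^X(\cdot,\omega,p)\,d\mu$ from $\Delta$ to $\mathbb R^\ell_+$ is Hausdorff continuous: its values are non-empty compact subsets of $\mathbb R^\ell_+$, and it is continuous as a map from $\Delta$ to the space of non-empty compact subsets of $\mathbb R^\ell$ with the Hausdorff metric induced by the Euclidean metric. -/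

import Mathlib

open MeasureTheory

namespace DiffInfoEconomy

/-- The commodity space `ℝ^ℓ` with its Euclidean metric. -/
abbrev Commodity (ℓ : ℕ) : Type := EuclideanSpace ℝ (Fin ℓ)

/-- The positive cone `ℝ^ℓ_+`, the consumption set of every agent. -/
def consumptionSet (ℓ : ℕ) : Set (Commodity ℓ) := {x | ∀ h, 0 ≤ x h}

/-- The simplex `Δ` of strictly positive normalized prices. -/
def priceSimplex (ℓ : ℕ) : Set (Commodity ℓ) := {p | (∀ h, 0 < p h) ∧ ∑ h, p h = 1}

section Integral

variable {T : Type*} [MeasurableSpace T]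

/-- The Aumann integral of a correspondence: the set of integrals of its integrable
(almost everywhere) selections. -/
def aumannIntegral {ℓ : ℕ} (μ : Measure T) (F : T → Set (Commodity ℓ)) : Set (Commodity ℓ) :=
  {z | ∃ f : T → Commodity ℓ, Integrable f μ ∧ (∀ᵐ t ∂μ, f t ∈ F t) ∧ ∫ t, f t ∂μ = z}

end Integral

/-- A correspondence is Hausdorff continuous if it is non-empty and compact-valued, and
continuous as a map into the space of non-empty compact sets with the Hausdorff metric
(the metric that `NonemptyCompacts` carries). -/
def HausdorffContinuous {G : Type*} [TopologicalSpace G] {ℓ : ℕ}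
    (F : G → Set (Commodity ℓ)) : Prop :=
  ∃ Φ : G → TopologicalSpace.NonemptyCompacts (Commodity ℓ),
    (∀ g, (Φ g : Set (Commodity ℓ)) = F g) ∧ Continuous Φ

section Economy

variable {T Ω : Type*} {ℓ : ℕ}

/-- The budget set `B(t, ω, p)`. -/
def budget (a : T → Ω → Commodity ℓ) (t : T) (ω : Ω) (p : Commodity ℓ) : Set (Commodity ℓ) :=
  {x | x ∈ consumptionSet ℓ ∧ inner ℝ p x ≤ inner ℝ p (a t ω)}

/-- The smallest coordinate `δ(p)`. -/
noncomputable def minPrice (p : Commodity ℓ) : ℝ := ⨅ h, p h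

/-- `γ(t, ω, p)`, the total quantity of the endowment divided by `δ(p)`. -/
noncomputable def gammaBound (a : T → Ω → Commodity ℓ) (t : T) (ω : Ω) (p : Commodity ℓ) : ℝ :=
  (1 / minPrice p) * ∑ h, a t ω h

/-- The truncation `X(t, ω, p)`: bundles dominated by `(γ(t, ω, p), …, γ(t, ω, p))`. -/
def truncation (a : T → Ω → Commodity ℓ) (t : T) (ω : Ω) (p : Commodity ℓ) :
    Set (Commodity ℓ) :=
  {x | x ∈ consumptionSet ℓ ∧ ∀ h, x h ≤ gammaBound a t ω p}

/-- `C(t, ω, p)`: bundles at least as good as every bundle in the budget set.  The utility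
is only ever evaluated on the consumption set. -/
def atLeastAsGood (a : T → Ω → Commodity ℓ) (U : T → Ω → Commodity ℓ → ℝ)
    (t : T) (ω : Ω) (p : Commodity ℓ) : Set (Commodity ℓ) :=
  {y | y ∈ consumptionSet ℓ ∧ ∀ x ∈ budget a t ω p, U t ω x ≤ U t ω y}

/-- The preferred set `C^X(t, ω, p) = C(t, ω, p) ∩ X(t, ω, p)`. -/
def preferredSet (a : T → Ω → Commodity ℓ) (U : T → Ω → Commodity ℓ → ℝ)
    (t : T) (ω : Ω) (p : Commodity ℓ) : Set (Commodity ℓ) :=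
  atLeastAsGood a U t ω p ∩ truncation a t ω p

/-- The aggregate preferred set at the state `ω` and the price `p`. -/
def aggregatePreferred [MeasurableSpace T] (μ : Measure T) (a : T → Ω → Commodity ℓ)
    (U : T → Ω → Commodity ℓ → ℝ) (ω : Ω) (p : Commodity ℓ) : Set (Commodity ℓ) :=
  aumannIntegral μ (fun t => preferredSet a U t ω p)

/-- (A₁): the endowment takes values in `ℝ^ℓ_+`, is jointly measurable, and for every state
its integral over the agents exists and is `≫ 0`. -/
def AssumptionA1 [MeasurableSpace T] [MeasurableSpace Ω] (μ : Measure T)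
    (a : T → Ω → Commodity ℓ) : Prop :=
  (∀ t ω, a t ω ∈ consumptionSet ℓ) ∧
  Measurable (fun z : T × Ω => a z.1 z.2) ∧
  ∀ ω, Integrable (fun t => a t ω) μ ∧ ∀ h, 0 < (∫ t, a t ω ∂μ) h

/-- (A₂): the utility is jointly measurable in agent and state for every fixed bundle, and
continuous in the bundle on `ℝ^ℓ_+`. -/
def AssumptionA2 [MeasurableSpace T] [MeasurableSpace Ω]
    (U : T → Ω → Commodity ℓ → ℝ) : Prop :=
  (∀ x ∈ consumptionSet ℓ, Measurable (fun z : T × Ω => U z.1 z.2 x)) ∧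
  ∀ t ω, ContinuousOn (U t ω) (consumptionSet ℓ)

/-- (A₃): the utility is strictly monotone on `ℝ^ℓ_+`. -/
def AssumptionA3 (U : T → Ω → Commodity ℓ → ℝ) : Prop :=
  ∀ t ω, ∀ x ∈ consumptionSet ℓ, ∀ y ∈ consumptionSet ℓ, y ≠ 0 → U t ω x < U t ω (x + y)

end Economy

end DiffInfoEconomy

open Set Filter Topology

/-! Hausdorff continuity is tested along price sequences `q n → p`, as an upper and a lower half.

Upper half: `γ` depends on the price only through `1 / minPrice`, so one integrable function bounds
all selections along the sequence, and their integrals accumulate somewhere. A finite-dimensional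
Fatou lemma, `exists_selection_of_tendsto_integral`, writes such a limit as the integral of
pointwise cluster points of the selections. These lie in the preferred sets at `p`, whose graph is
closed because affordable bundles can be followed to nearby prices (`exists_seq_mem_budget`).
Preferred sets need not be convex; the convexity used by Fatou's lemma comes from Lyapunov's theorem
off the atoms, while the countably many atoms are settled by a convergent subsequence.

Lower half: a preferred bundle pushed slightly towards the top `(γ, …, γ)` of the truncation becomes
strictly better than the budget set if `ℓ ≠ 1` and the endowment is nonzero. After rescaling it
therefore stays preferred at nearby prices (`eventually_approxBundle_mem`). The size of the push is
chosen measurably in the agent and tends to zero, and dominated convergence passes to the integrals.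
For `ℓ = 1` there is only one price. -/

/-- A family of functions is bisectable with respect to `μ` if every measurable set has a
measurable subset over which each integral is halved. -/
def Bisectable {T : Type*} [MeasurableSpace T] (μ : Measure T) (H : Set (T → ℝ)) : Prop :=
  ∀ E, MeasurableSet E → ∃ A ⊆ E, MeasurableSet A ∧
    ∀ h ∈ H, ∫ t in A, h t ∂μ = (1 / 2) * ∫ t in E, h t ∂μ

/-! ### Dyadic chains of sets. -/

section Dyadic

variable {T : Type*}

/-- The dyadic refinement of the chain `∅ ⊆ E`, given a rule `half` cutting a set. -/
noncomputable def dyadicChain (half : Set T → Set T) (E : Set T) : ℕ → ℕ → Set T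
  | 0, k => if k = 0 then ∅ else E
  | n + 1, k => if k % 2 = 0 then dyadicChain half E n (k / 2) else
      dyadicChain half E n (k / 2) ∪
        half (dyadicChain half E n (k / 2 + 1) \ dyadicChain half E n (k / 2))

variable {half : Set T → Set T} {E : Set T}

lemma dyadicChain_zero_zero : dyadicChain half E 0 0 = ∅ := by simp [dyadicChain]

lemma dyadicChain_zero_succ (k : ℕ) : dyadicChain half E 0 (k + 1) = E := by simp [dyadicChain]

lemma dyadicChain_even (n j : ℕ) :
    dyadicChain half E (n + 1) (2 * j) = dyadicChain half E n j := by
  simp [dyadicChain]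

lemma dyadicChain_odd (n j : ℕ) :
    dyadicChain half E (n + 1) (2 * j + 1) = dyadicChain half E n j ∪
      half (dyadicChain half E n (j + 1) \ dyadicChain half E n j) := by
  have h1 : (2 * j + 1) / 2 = j := by omega
  simp [dyadicChain, h1, Nat.add_mod]

lemma dyadicChain_le_succ (hsub : ∀ S, half S ⊆ S) (n k : ℕ) :
    dyadicChain half E n k ⊆ dyadicChain half E n (k + 1) := by
  induction n generalizing k with
  | zero =>
    rcases k with _ | k
    · simp [dyadicChain_zero_zero]
    · simp [dyadicChain_zero_succ]
  | succ n ih =>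
    obtain ⟨j, rfl | rfl⟩ := Nat.even_or_odd' k
    · rw [dyadicChain_even, dyadicChain_odd]
      exact subset_union_left
    · rw [show 2 * j + 1 + 1 = 2 * (j + 1) by ring, dyadicChain_even, dyadicChain_odd]
      exact union_subset (ih j) ((hsub _).trans sdiff_subset)

lemma dyadicChain_mono (hsub : ∀ S, half S ⊆ S) (n : ℕ) :
    Monotone (dyadicChain half E n) :=
  monotone_nat_of_le_succ fun k => dyadicChain_le_succ hsub n k

lemma dyadicChain_subset (hsub : ∀ S, half S ⊆ S) (n k : ℕ) : dyadicChain half E n k ⊆ E := by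
  induction n generalizing k with
  | zero =>
    rcases k with _ | k
    · simp [dyadicChain_zero_zero]
    · simp [dyadicChain_zero_succ]
  | succ n ih =>
    obtain ⟨j, rfl | rfl⟩ := Nat.even_or_odd' k
    · rw [dyadicChain_even]
      exact ih j
    · rw [dyadicChain_odd]
      exact union_subset (ih j) (((hsub _).trans sdiff_subset).trans (ih _))

variable [MeasurableSpace T]

lemma measurableSet_dyadicChain (hE : MeasurableSet E)
    (hmeas : ∀ S, MeasurableSet S → MeasurableSet (half S)) (n k : ℕ) :
    MeasurableSet (dyadicChain half E n k) := by
  induction n generalizing k with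
  | zero =>
    rcases k with _ | k
    · simp [dyadicChain_zero_zero]
    · simpa [dyadicChain_zero_succ] using hE
  | succ n ih =>
    obtain ⟨j, rfl | rfl⟩ := Nat.even_or_odd' k
    · rw [dyadicChain_even]
      exact ih j
    · rw [dyadicChain_odd]
      exact (ih j).union (hmeas _ ((ih _).diff (ih _)))

/-- An odd position adds half the gap between consecutive sets of the previous level, so its
integral is the mean of its two neighbours'. -/
lemma setIntegral_dyadicChain {μ : Measure T} {h : T → ℝ} (hh : Integrable h μ)
    (hE : MeasurableSet E) (hsub : ∀ S, half S ⊆ S)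
    (hmeas : ∀ S, MeasurableSet S → MeasurableSet (half S))
    (hhalf : ∀ S, MeasurableSet S → ∫ t in half S, h t ∂μ = (1 / 2) * ∫ t in S, h t ∂μ)
    (n k : ℕ) (hk : k ≤ 2 ^ n) :
    ∫ t in dyadicChain half E n k, h t ∂μ = (k / 2 ^ n) * ∫ t in E, h t ∂μ := by
  induction n generalizing k with
  | zero =>
    rcases k with _ | k
    · simp [dyadicChain_zero_zero]
    · obtain rfl : k = 0 := by simpa using hk
      simp [dyadicChain_zero_succ]
  | succ n ih =>
    have hm := measurableSet_dyadicChain (half := half) hE hmeas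
    obtain ⟨j, rfl | rfl⟩ := Nat.even_or_odd' k
    · rw [dyadicChain_even, ih j (by rw [pow_succ] at hk; omega)]
      push_cast
      rw [pow_succ]
      field_simp
    · have hj : j + 1 ≤ 2 ^ n := by rw [pow_succ] at hk; omega
      rw [dyadicChain_odd, setIntegral_union (disjoint_sdiff_right.mono_right (hsub _))
        (hmeas _ ((hm _ _).diff (hm _ _))) hh.integrableOn hh.integrableOn,
        hhalf _ ((hm _ _).diff (hm _ _)),
        setIntegral_sdiff (hm _ _) hh.integrableOn (dyadicChain_le_succ hsub n j),
        ih _ hj, ih j (by omega)]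
      push_cast
      rw [pow_succ]
      field_simp
      ring

end Dyadic

/-! ### Lyapunov's theorem by bisection. -/

section Bisection

variable {T : Type*} [MeasurableSpace T] {μ : Measure T} {H : Set (T → ℝ)}

/-- Repeated bisection yields a chain of sets along which all the integrals grow linearly. -/
lemma Bisectable.exists_chain (hb : Bisectable μ H) (hH : ∀ h ∈ H, Integrable h μ)
    {E : Set T} (hE : MeasurableSet E) :
    ∃ G : ℝ → Set T, Monotone G ∧ (∀ s, MeasurableSet (G s)) ∧ (∀ s, G s ⊆ E) ∧
      ∀ h ∈ H, ∀ s ∈ Icc (0 : ℝ) 1, ∫ t in G s, h t ∂μ = s * ∫ t in E, h t ∂μ := by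
  classical
  choose! half hsub hmeas hhalf using hb
  -- The default `∅` on non-measurable sets makes `half' S ⊆ S` hold for every `S`.
  set half' : Set T → Set T := fun S => if MeasurableSet S then half S else ∅ with hdef
  have hsub' : ∀ S, half' S ⊆ S := by
    intro S
    by_cases hS : MeasurableSet S
    · simpa [hdef, hS] using hsub S hS
    · simp [hdef, hS]
  have hmeas' : ∀ S, MeasurableSet S → MeasurableSet (half' S) := by
    intro S hS
    simpa [hdef, hS] using hmeas S hS
  have hm := measurableSet_dyadicChain (half := half') hE hmeas'
  -- A real `s` is approached from below by dyadic fractions; the integral is continuous along the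
  -- increasing union.
  refine ⟨fun s => ⋃ n : ℕ, dyadicChain half' E n ⌊s * 2 ^ n⌋₊, ?_, ?_, ?_, ?_⟩
  · intro s s' hss
    refine iUnion_mono fun n => dyadicChain_mono hsub' n (Nat.floor_mono ?_)
    gcongr
  · exact fun s => MeasurableSet.iUnion fun n => hm _ _
  · exact fun s => iUnion_subset fun n => dyadicChain_subset hsub' _ _
  · intro h hh s hs
    have hmono : Monotone fun n : ℕ => dyadicChain half' E n ⌊s * 2 ^ n⌋₊ := by
      refine monotone_nat_of_le_succ fun n => ?_
      show dyadicChain half' E n ⌊s * 2 ^ n⌋₊ ⊆ dyadicChain half' E (n + 1) ⌊s * 2 ^ (n + 1)⌋₊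
      rw [← dyadicChain_even (half := half') (E := E) n]
      refine dyadicChain_mono hsub' _ (Nat.le_floor ?_)
      have : (⌊s * 2 ^ n⌋₊ : ℝ) ≤ s * 2 ^ n := Nat.floor_le (mul_nonneg hs.1 (by positivity))
      push_cast
      rw [pow_succ]
      linarith
    have h1 := tendsto_setIntegral_of_monotone (μ := μ) (f := h)
      (fun n => hm n ⌊s * 2 ^ n⌋₊) hmono (hH h hh).integrableOn
    have h2 : ∀ n : ℕ, ∫ t in dyadicChain half' E n ⌊s * 2 ^ n⌋₊, h t ∂μ
        = ((⌊s * 2 ^ n⌋₊ : ℝ) / 2 ^ n) * ∫ t in E, h t ∂μ := by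
      intro n
      refine setIntegral_dyadicChain (hH h hh) hE hsub' hmeas' ?_ n _ ?_
      · intro S hS
        simpa [hdef, hS] using hhalf S hS h hh
      · refine Nat.floor_le_of_le ?_
        push_cast
        have : (0 : ℝ) < 2 ^ n := by positivity
        nlinarith [hs.2]
    simp_rw [h2] at h1
    refine tendsto_nhds_unique h1 (Tendsto.mul_const _ ?_)
    exact (tendsto_nat_floor_mul_div_atTop hs.1).comp
      (tendsto_pow_atTop_atTop_of_one_lt (one_lt_two : (1 : ℝ) < 2))

/-- Integrals over a chain of uniformly growing measure are continuous in the parameter. -/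
lemma continuousOn_setIntegral_of_chain [IsFiniteMeasure μ] {G : ℝ → Set T} (hmono : Monotone G)
    (hmeas : ∀ s, MeasurableSet (G s)) {c : ℝ}
    (hc : ∀ s ∈ Icc (0 : ℝ) 1, μ.real (G s) = s * c) {k : T → ℝ} (hk : Integrable k μ) :
    ContinuousOn (fun s => ∫ t in G s, k t ∂μ) (Icc 0 1) := by
  have key : ∀ s ∈ Icc (0 : ℝ) 1, ∀ s' ∈ Icc (0 : ℝ) 1, μ.real (G s \ G s') ≤ |s - s'| * |c| := by
    intro s hs s' hs'
    rcases le_total s s' with hss | hss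
    · rw [sdiff_eq_empty.2 (hmono hss)]
      simp only [measureReal_empty]
      positivity
    · rw [measureReal_sdiff (hmono hss) (hmeas _), hc s hs, hc s' hs', ← sub_mul, ← abs_mul]
      exact le_abs_self _
  intro s hs
  have hid : ∀ s', ∫ t in G s', k t ∂μ = ∫ t in G s, k t ∂μ + ∫ t in G s' \ G s, k t ∂μ
      - ∫ t in G s \ G s', k t ∂μ := by
    intro s'
    rcases le_total s s' with hss | hss
    · rw [sdiff_eq_empty.2 (hmono hss),
        setIntegral_sdiff (hmeas s) hk.integrableOn (hmono hss)]
      simp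
    · rw [sdiff_eq_empty.2 (hmono hss),
        setIntegral_sdiff (hmeas s') hk.integrableOn (hmono hss)]
      simp
  have habs : Tendsto (fun s' => |s' - s| * |c|) (𝓝[Icc 0 1] s) (𝓝 0) := by
    have : Continuous fun s' : ℝ => |s' - s| * |c| := by fun_prop
    simpa using (this.tendsto s).mono_left nhdsWithin_le_nhds
  have hzero : ∀ S : ℝ → Set T, (∀ᶠ s' in 𝓝[Icc 0 1] s, μ.real (S s') ≤ |s' - s| * |c|) →
      Tendsto (fun s' => ∫ t in S s', k t ∂μ) (𝓝[Icc 0 1] s) (𝓝 0) := by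
    intro S hS
    refine hk.tendsto_setIntegral_nhds_zero ?_
    have h1 : Tendsto (fun s' => μ.real (S s')) (𝓝[Icc 0 1] s) (𝓝 0) :=
      squeeze_zero' (Eventually.of_forall fun _ => measureReal_nonneg) hS habs
    have h2 := ENNReal.tendsto_ofReal h1
    simpa [Function.comp_def, ofReal_measureReal] using h2
  have h1 := hzero (fun s' => G s' \ G s)
    (eventually_nhdsWithin_of_forall fun s' hs' => key s' hs' s hs)
  have h2 := hzero (fun s' => G s \ G s')
    (eventually_nhdsWithin_of_forall fun s' hs' => by
      rw [abs_sub_comm]; exact key s hs s' hs')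
  have h3 := ((tendsto_const_nhds (x := ∫ t in G s, k t ∂μ)).add h1).sub h2
  rw [ContinuousWithinAt]
  simp only [add_zero, sub_zero] at h3
  exact h3.congr fun s' => (hid s').symm

/-- Every window `G (s + 1 / 2) \ G s` of a chain carries half of each old integral. Sliding it
changes the integral of `k` continuously, because the constant `1` in `H` controls the measure of
the sets. The windows at `s = 0` and `s = 1 / 2` tile `E` up to a null set, so the intermediate
value theorem gives a window that also halves `k`. -/
lemma Bisectable.insert [IsFiniteMeasure μ] (hb : Bisectable μ H) (hH : ∀ h ∈ H, Integrable h μ)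
    (h1 : (fun _ => 1) ∈ H) {k : T → ℝ} (hk : Integrable k μ) : Bisectable μ (insert k H) := by
  intro E hE
  obtain ⟨G, hmono, hmeas, hsub, hG⟩ := hb.exists_chain hH hE
  have hreal : ∀ s ∈ Icc (0 : ℝ) 1, μ.real (G s) = s * μ.real E := by
    intro s hs
    simpa using hG _ h1 s hs
  set F : ℝ → ℝ := fun s => ∫ t in G s, k t ∂μ with hF
  have hcont : ContinuousOn F (Icc 0 1) := continuousOn_setIntegral_of_chain hmono hmeas hreal hk
  have hdiff : ∀ (s : ℝ) (h : T → ℝ), Integrable h μ →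
      ∫ t in G (s + 1 / 2) \ G s, h t ∂μ = ∫ t in G (s + 1 / 2), h t ∂μ - ∫ t in G s, h t ∂μ :=
    fun s h hh => setIntegral_sdiff (hmeas s) hh.integrableOn (hmono (by linarith))
  have hF0 : F 0 = 0 := by
    refine setIntegral_measure_zero _ ?_
    have := hreal 0 (by simp)
    rwa [zero_mul, measureReal_eq_zero_iff] at this
  have hF1 : F 1 = ∫ t in E, k t ∂μ := by
    refine setIntegral_congr_set ?_
    refine ae_eq_of_subset_of_measure_ge (hsub 1) ?_ (hmeas 1).nullMeasurableSet (by simp)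
    have := hreal 1 (by simp)
    rw [one_mul, Measure.real, Measure.real,
      ENNReal.toReal_eq_toReal_iff' (by simp) (by simp)] at this
    exact this.ge
  set D : ℝ → ℝ := fun s => F (s + 1 / 2) - F s with hD
  have hDcont : ContinuousOn D (Icc 0 (1 / 2)) := by
    refine ContinuousOn.sub (hcont.comp (by fun_prop) ?_) (hcont.mono ?_)
    · intro s hs
      exact ⟨by linarith [hs.1], by linarith [hs.2]⟩
    · exact Icc_subset_Icc_right (by norm_num)
  have hDsum : D 0 + D (1 / 2) = ∫ t in E, k t ∂μ := by
    simp only [hD, zero_add, hF0, show (1 / 2 : ℝ) + 1 / 2 = 1 by norm_num, hF1]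
    ring
  have hex : ∃ s ∈ Icc (0 : ℝ) (1 / 2), D s = (1 / 2) * ∫ t in E, k t ∂μ := by
    rcases le_total (D 0) (D (1 / 2)) with hle | hle
    · exact intermediate_value_Icc (by norm_num) hDcont ⟨by linarith, by linarith⟩
    · exact intermediate_value_Icc' (by norm_num) hDcont ⟨by linarith, by linarith⟩
  obtain ⟨s, hs, hDs⟩ := hex
  refine ⟨G (s + 1 / 2) \ G s, sdiff_subset.trans (hsub _), (hmeas _).diff (hmeas _), ?_⟩
  rintro h (rfl | hh)
  · rw [hdiff s _ hk]
    exact hDs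
  · rw [hdiff s _ (hH h hh), hG h hh _ ⟨by linarith [hs.1], by linarith [hs.2]⟩,
      hG h hh s ⟨hs.1, by linarith [hs.2]⟩]
    ring

lemma Bisectable.of_finite [IsFiniteMeasure μ] (hb : Bisectable μ {fun _ => 1})
    (hfin : H.Finite) (hH : ∀ h ∈ H, Integrable h μ) : Bisectable μ (H ∪ {fun _ => 1}) := by
  induction H, hfin using Set.Finite.induction_on with
  | empty => simpa using hb
  | @insert k S _ _ ih =>
    rw [insert_union]
    refine (ih fun h hh => hH h (mem_insert_of_mem _ hh)).insert ?_ (by simp) (hH k (by simp))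
    rintro h (hh | rfl)
    · exact hH h (mem_insert_of_mem _ hh)
    · exact integrable_const _

/-- A measure on the real line without point masses can be bisected. -/
lemma bisectable_one_of_nullSingleton (ν : Measure ℝ) [IsFiniteMeasure ν] [NullSingletonClass ν] :
    Bisectable ν {fun _ => 1} := by
  intro E hE
  set ρ := ν.restrict E with hρ
  -- The distribution function is continuous since points are null, and so attains half of the total
  -- mass.
  set F : ℝ → ℝ := fun x => ρ.real (Iic x) with hF
  have hcont : Continuous F := by
    have h1 : Continuous fun b => ∫ _ in (0 : ℝ)..b, (1 : ℝ) ∂ρ :=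
      intervalIntegral.continuous_primitive (fun a b => intervalIntegrable_const) 0
    have h2 : ∀ b, F b = F 0 + ∫ _ in (0 : ℝ)..b, (1 : ℝ) ∂ρ := by
      intro b
      have := intervalIntegral.integral_Iic_sub_Iic (μ := ρ) (f := fun _ => (1 : ℝ)) (a := 0)
        (b := b) (integrable_const _).integrableOn (integrable_const _).integrableOn
      rw [← this]
      simp [hF]
    rw [funext h2]
    exact continuous_const.add h1
  have htop : Tendsto F atTop (𝓝 (ρ.real univ)) :=
    (ENNReal.tendsto_toReal (measure_ne_top ρ _)).comp (tendsto_measure_Iic_atTop ρ)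
  have hbot : Tendsto F atBot (𝓝 0) := by
    have h1 : Tendsto (fun x => ρ.real (Ici x)) atBot (𝓝 (ρ.real univ)) :=
      (ENNReal.tendsto_toReal (measure_ne_top ρ _)).comp (tendsto_measure_Ici_atBot ρ)
    have h2 := (tendsto_const_nhds (x := ρ.real univ)).sub h1
    rw [sub_self] at h2
    refine h2.congr fun x => ?_
    have h3 : ρ.real (Iic x) + ρ.real (Iic x)ᶜ = ρ.real univ :=
      measureReal_add_measureReal_compl measurableSet_Iic
    have h4 : ρ.real (Ici x) = ρ.real (Iic x)ᶜ := by
      rw [compl_Iic]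
      exact (measureReal_congr Ioi_ae_eq_Ici).symm
    simp only [hF]
    linarith
  rcases eq_or_lt_of_le (measureReal_nonneg (μ := ρ) (s := univ)) with h0 | hpos
  · refine ⟨∅, by simp, by simp, ?_⟩
    rintro _ rfl
    simp [← h0]
  · obtain ⟨x, hx⟩ := mem_range_of_exists_le_of_exists_ge hcont
      (c := ρ.real univ / 2)
      ((hbot.eventually (ge_mem_nhds (by linarith))).exists)
      ((htop.eventually (le_mem_nhds (by linarith))).exists)
    refine ⟨Iic x ∩ E, inter_subset_right, measurableSet_Iic.inter hE, ?_⟩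
    rintro _ rfl
    simp only [hF, hρ, measureReal_restrict_apply measurableSet_Iic,
      measureReal_restrict_apply MeasurableSet.univ, univ_inter] at hx
    simp only [integral_const, measureReal_restrict_apply_univ, smul_eq_mul, mul_one, hρ, hx]
    ring

/-- **Lyapunov's convexity theorem**, in the form used for integrals of correspondences. -/
lemma exists_setIntegral_eq_smul (ν : Measure ℝ) [IsFiniteMeasure ν] [NullSingletonClass ν]
    {ι : Type*} [Fintype ι] {f : ℝ → EuclideanSpace ℝ ι} (hf : Integrable f ν) {s : ℝ}
    (hs : s ∈ Icc (0 : ℝ) 1) :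
    ∃ A, MeasurableSet A ∧ ∫ t in A, f t ∂ν = s • ∫ t, f t ∂ν := by
  have hfi : ∀ i, Integrable (fun t => f t i) ν := fun i =>
    (EuclideanSpace.proj (𝕜 := ℝ) i).integrable_comp hf
  have hH : ∀ h ∈ range fun (i : ι) (t : ℝ) => f t i, Integrable h ν := by
    rintro _ ⟨i, rfl⟩
    exact hfi i
  have hb := (bisectable_one_of_nullSingleton ν).of_finite (finite_range _) hH
  obtain ⟨G, -, hmeas, -, hG⟩ := hb.exists_chain (by
    rintro h (hh | rfl)
    · exact hH h hh
    · exact integrable_const _) MeasurableSet.univ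
  refine ⟨G s, hmeas s, ?_⟩
  ext i
  have h1 := hG _ (Or.inl ⟨i, rfl⟩) s hs
  have h2 := (EuclideanSpace.proj (𝕜 := ℝ) i).integral_comp_comm (hf.integrableOn (s := G s))
  have h3 := (EuclideanSpace.proj (𝕜 := ℝ) i).integral_comp_comm hf
  rw [PiLp.smul_apply]
  change ∫ t in G s, f t i ∂ν = (∫ t in G s, f t ∂ν) i at h2
  change ∫ t, f t i ∂ν = (∫ t, f t ∂ν) i at h3
  rw [← h2, ← h3, h1, setIntegral_univ, smul_eq_mul]

end Bisection

/-! ### Measurable selection of cluster points. -/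

section Selection

variable {T : Type*} [MeasurableSpace T]

lemma Measurable.apply_index {β : Type*} [MeasurableSpace β] {f : ℕ → T → β}
    (hf : ∀ n, Measurable (f n)) {N : T → ℕ} (hN : Measurable N) :
    Measurable fun t => f (N t) t := by
  have h : Measurable fun q : T × ℕ => f q.2 q.1 :=
    measurable_from_prod_countable_left fun n => hf n
  exact h.comp (measurable_id.prodMk hN)

/-- A pointwise bounded sequence of measurable functions attains its upper limit along a
measurably chosen sequence of indices. -/
lemma exists_measurable_index_tendsto_limsup {u : ℕ → T → ℝ} (hu : ∀ n, Measurable (u n))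
    {g : T → ℝ} (hb : ∀ n t, |u n t| ≤ g t) :
    ∃ N : ℕ → T → ℕ, (∀ k, Measurable (N k)) ∧ (∀ k t, k ≤ N k t) ∧
      ∀ t, Tendsto (fun k => u (N k t) t) atTop (𝓝 (limsup (fun n => u n t) atTop)) := by
  classical
  set M : T → ℝ := fun t => limsup (fun n => u n t) atTop with hM
  have hMm : Measurable M := Measurable.limsup hu
  have hbdd : ∀ t, IsBoundedUnder (· ≤ ·) atTop fun n => u n t := fun t =>
    isBoundedUnder_of ⟨g t, fun n => (abs_le.1 (hb n t)).2⟩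
  have hcob : ∀ t, IsBoundedUnder (· ≥ ·) atTop fun n => u n t := fun t =>
    isBoundedUnder_of ⟨-g t, fun n => (abs_le.1 (hb n t)).1⟩
  -- Choosing the least such index keeps the selection measurable.
  have hex : ∀ (k : ℕ) (t : T), ∃ n, k ≤ n ∧ M t - 1 / ((k : ℝ) + 1) < u n t := by
    intro k t
    have hlt : M t - 1 / ((k : ℝ) + 1) < M t := sub_lt_self _ (by positivity)
    exact ((frequently_lt_of_lt_limsup (hcob t).isCoboundedUnder_le hlt).and_eventually
      (eventually_ge_atTop k)).exists.imp fun n h => ⟨h.2, h.1⟩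
  refine ⟨fun k t => Nat.find (hex k t), fun k => ?_, fun k t => (Nat.find_spec (hex k t)).1, ?_⟩
  · refine measurable_find (hex k) fun n => ?_
    exact (MeasurableSet.const _).inter
      (measurableSet_lt (hMm.sub_const _) (hu n))
  · intro t
    have hN : Tendsto (fun k => Nat.find (hex k t)) atTop atTop :=
      tendsto_atTop_mono (fun k => (Nat.find_spec (hex k t)).1) tendsto_id
    refine tendsto_order.2 ⟨fun c hc => ?_, fun c hc => ?_⟩
    · have h1 : Tendsto (fun k : ℕ => M t - 1 / ((k : ℝ) + 1)) atTop (𝓝 (M t - 0)) :=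
        tendsto_const_nhds.sub tendsto_one_div_add_atTop_nhds_zero_nat
      rw [sub_zero] at h1
      exact (h1.eventually (lt_mem_nhds hc)).mono fun k hk =>
        hk.trans (Nat.find_spec (hex k t)).2
    · exact hN.eventually (eventually_lt_of_limsup_lt hc (hbdd t))

/-- A measurable Bolzano–Weierstrass argument: each function thins the indices left by the previous
ones, and limits already obtained survive the thinning. -/
lemma exists_measurable_index_tendsto {ι : Type*} (S : Finset ι) {u : ι → ℕ → T → ℝ}
    (hu : ∀ i n, Measurable (u i n)) {g : ι → T → ℝ} (hb : ∀ i n t, |u i n t| ≤ g i t) :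
    ∃ N : ℕ → T → ℕ, (∀ k, Measurable (N k)) ∧ (∀ k t, k ≤ N k t) ∧
      ∀ i ∈ S, ∀ t, ∃ c, Tendsto (fun k => u i (N k t) t) atTop (𝓝 c) := by
  classical
  induction S using Finset.induction_on with
  | empty => exact ⟨fun k _ => k, fun k => measurable_const, fun k t => le_rfl, by simp⟩
  | insert j S _ ih =>
    obtain ⟨N, hNm, hN, hconv⟩ := ih
    obtain ⟨K, hKm, hK, hlim⟩ := exists_measurable_index_tendsto_limsup
      (u := fun k t => u j (N k t) t) (fun k => Measurable.apply_index (hu j) (hNm k))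
      (fun k t => hb j _ t)
    refine ⟨fun k t => N (K k t) t, fun k => Measurable.apply_index hNm (hKm k),
      fun k t => (hK k t).trans (hN _ t), ?_⟩
    intro i hi t
    have hKt : Tendsto (fun k => K k t) atTop atTop :=
      tendsto_atTop_mono (fun k => hK k t) tendsto_id
    rcases Finset.mem_insert.1 hi with rfl | hi
    · exact ⟨_, hlim t⟩
    · obtain ⟨c, hc⟩ := hconv i hi t
      exact ⟨c, hc.comp hKt⟩

/-- A pointwise bounded sequence has a measurable selection of cluster points that attains the
upper limit of a given linear functional. -/
lemma exists_measurable_mapClusterPt {ι : Type*} [Fintype ι] {f : ℕ → T → EuclideanSpace ℝ ι}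
    (hf : ∀ n, Measurable (f n)) {g : T → ℝ} (hb : ∀ n t, ‖f n t‖ ≤ g t)
    (p : EuclideanSpace ℝ ι) :
    ∃ F : T → EuclideanSpace ℝ ι, Measurable F ∧ ∀ t,
      MapClusterPt (F t) atTop (fun n => f n t) ∧
      inner ℝ p (F t) = limsup (fun n => inner ℝ p (f n t)) atTop := by
  classical
  obtain ⟨N, hNm, hN, hlim⟩ := exists_measurable_index_tendsto_limsup
    (u := fun n t => inner ℝ p (f n t)) (g := fun t => ‖p‖ * g t)
    (fun n => measurable_const.inner (hf n))
    (fun n t => (abs_real_inner_le_norm _ _).trans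
      (mul_le_mul_of_nonneg_left (hb n t) (norm_nonneg _)))
  obtain ⟨K, hKm, hK, hconv⟩ := exists_measurable_index_tendsto (Finset.univ : Finset ι)
    (u := fun i k t => f (N k t) t i) (g := fun _ => g)
    (fun i k => (EuclideanSpace.proj (𝕜 := ℝ) i).measurable.comp
      (Measurable.apply_index hf (hNm k)))
    (fun i k t => (PiLp.norm_apply_le (f (N k t) t) i).trans (hb _ t))
  choose c hc using fun i t => hconv i (Finset.mem_univ i) t
  have hF : ∀ t, Tendsto (fun k => f (N (K k t) t) t) atTop
      (𝓝 (WithLp.toLp 2 fun i => c i t)) := by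
    intro t
    have h1 : Tendsto (fun k => (f (N (K k t) t) t).ofLp) atTop (𝓝 fun i => c i t) :=
      tendsto_pi_nhds.2 fun i => hc i t
    exact ((PiLp.continuous_toLp 2 _).tendsto _).comp h1
  refine ⟨fun t => WithLp.toLp 2 fun i => c i t, ?_, fun t => ⟨?_, ?_⟩⟩
  · refine measurable_of_tendsto_metrizable
      (fun k => Measurable.apply_index hf (Measurable.apply_index hNm (hKm k)))
      (tendsto_pi_nhds.2 hF)
  · refine MapClusterPt.of_comp (φ := fun k => N (K k t) t) (p := atTop) ?_ (hF t).mapClusterPt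
    exact tendsto_atTop_mono (fun k => (hK k t).trans (hN _ t)) tendsto_id
  · have hKt : Tendsto (fun k => K k t) atTop atTop :=
      tendsto_atTop_mono (fun k => hK k t) tendsto_id
    exact tendsto_nhds_unique (tendsto_const_nhds.inner (hF t)) ((hlim t).comp hKt)

end Selection

/-! ### Weak separation in finite dimension. -/

section Separation

/-- In finite dimension a point outside a convex set can be weakly separated from it. -/
lemma Convex.exists_ne_zero_inner_nonpos {V : Type*} [NormedAddCommGroup V]
    [InnerProductSpace ℝ V] [FiniteDimensional ℝ V] {C : Set V} (hC : Convex ℝ C)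
    (hne : C.Nonempty) (h0 : (0 : V) ∉ C) : ∃ p : V, p ≠ 0 ∧ ∀ c ∈ C, inner ℝ p c ≤ 0 := by
  by_cases hint : (interior C).Nonempty
  · obtain ⟨f, hf0, hf⟩ := geometric_hahn_banach_of_nonempty_interior_point hC
      (fun h => h0 (interior_subset h)) hint
    refine ⟨(InnerProductSpace.toDual ℝ V).symm f, by simpa using hf0, fun c hc => ?_⟩
    simpa using hf c hc
  · rw [hC.interior_nonempty_iff_affineSpan_eq_top] at hint
    obtain ⟨c₀, hc₀⟩ := hne
    have hdir : (affineSpan ℝ C).direction ≠ ⊤ := fun h => hint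
      ((AffineSubspace.direction_eq_top_iff_of_nonempty ⟨c₀, subset_affineSpan ℝ C hc₀⟩).1 h)
    obtain ⟨p, hp, hp0⟩ : ∃ p ∈ ((affineSpan ℝ C).direction)ᗮ, p ≠ 0 :=
      Submodule.exists_mem_ne_zero_of_ne_bot fun h => hdir (Submodule.orthogonal_eq_bot_iff.1 h)
    have hconst : ∀ c ∈ C, inner ℝ p c = inner ℝ p c₀ := by
      intro c hc
      have h1 : c - c₀ ∈ (affineSpan ℝ C).direction :=
        AffineSubspace.vsub_mem_direction (subset_affineSpan ℝ C hc) (subset_affineSpan ℝ C hc₀)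
      have h2 := Submodule.inner_left_of_mem_orthogonal h1 hp
      rwa [inner_sub_right, sub_eq_zero] at h2
    rcases le_total (inner ℝ p c₀) 0 with h | h
    · exact ⟨p, hp0, fun c hc => (hconst c hc).trans_le h⟩
    · refine ⟨-p, neg_ne_zero.2 hp0, fun c hc => ?_⟩
      rw [inner_neg_left, hconst c hc]
      linarith

/-- Separation inside a subspace containing the convex set. -/
lemma Convex.exists_mem_submodule_inner_nonpos {V : Type*} [NormedAddCommGroup V]
    [InnerProductSpace ℝ V] [FiniteDimensional ℝ V] {C : Set V} (hC : Convex ℝ C)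
    (hne : C.Nonempty) (h0 : (0 : V) ∉ C) {W : Submodule ℝ V} (hW : C ⊆ W) :
    ∃ p ∈ W, p ≠ 0 ∧ ∀ c ∈ C, inner ℝ p c ≤ 0 := by
  obtain ⟨c₀, hc₀⟩ := hne
  obtain ⟨p, hp0, hp⟩ := (hC.linear_preimage W.subtype).exists_ne_zero_inner_nonpos
    ⟨⟨c₀, hW hc₀⟩, hc₀⟩ (by simpa using h0)
  exact ⟨p, p.2, by simpa using hp0, fun c hc => hp ⟨c, hW hc⟩ hc⟩

end Separation

/-! ### Fatou's lemma in finite dimension. -/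

section Fatou

lemma MapClusterPt.norm_le {V : Type*} [SeminormedAddCommGroup V] {u : ℕ → V} {y : V} {r : ℝ}
    (hy : MapClusterPt y atTop u) (hu : ∀ n, ‖u n‖ ≤ r) : ‖y‖ ≤ r := by
  have h : IsClosed {z : V | ‖z‖ ≤ r} := isClosed_le continuous_norm continuous_const
  exact h.mem_of_mapClusterPt hy (Eventually.of_forall hu)

lemma MapClusterPt.eq_of_tendsto {X Y : Type*} [TopologicalSpace X] [TopologicalSpace Y]
    [T2Space Y] {u : ℕ → X} {y : X} {φ : X → Y} {c : Y} (hy : MapClusterPt y atTop u)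
    (hφ : Continuous φ) (hc : Tendsto (fun n => φ (u n)) atTop (𝓝 c)) : φ y = c := by
  have h1 : MapClusterPt (φ y) atTop (φ ∘ u) := hy.continuousAt_comp hφ.continuousAt
  have h2 : (𝓝 (φ y) ⊓ 𝓝 c).NeBot := ClusterPt.mono h1 hc
  exact eq_of_nhds_neBot h2

/-- If the integrals of a dominated sequence do not drop below the integral of its upper limit,
then a subsequence converges almost everywhere to the upper limit. -/
lemma exists_subseq_tendsto_limsup {T : Type*} [MeasurableSpace T] {μ : Measure T}
    {u : ℕ → T → ℝ} (hu : ∀ n, Measurable (u n)) {g : T → ℝ} (hg : Integrable g μ)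
    (hb : ∀ n t, |u n t| ≤ g t) {c : ℝ} (hc : Tendsto (fun n => ∫ t, u n t ∂μ) atTop (𝓝 c))
    (hle : ∫ t, limsup (fun n => u n t) atTop ∂μ ≤ c) :
    ∃ φ : ℕ → ℕ, StrictMono φ ∧
      ∀ᵐ t ∂μ, Tendsto (fun n => u (φ n) t) atTop (𝓝 (limsup (fun n => u n t) atTop)) := by
  set M : T → ℝ := fun t => limsup (fun n => u n t) atTop with hM
  have hMm : Measurable M := Measurable.limsup hu
  have hbdd : ∀ t, IsBoundedUnder (· ≤ ·) atTop fun n => u n t := fun t =>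
    isBoundedUnder_of ⟨g t, fun n => (abs_le.1 (hb n t)).2⟩
  have hcob : ∀ t, IsBoundedUnder (· ≥ ·) atTop fun n => u n t := fun t =>
    isBoundedUnder_of ⟨-g t, fun n => (abs_le.1 (hb n t)).1⟩
  have hMg : ∀ t, |M t| ≤ g t := by
    intro t
    refine abs_le.2 ⟨?_, ?_⟩
    · exact le_limsup_of_frequently_le
        (Frequently.of_forall fun n => (abs_le.1 (hb n t)).1) (hbdd t)
    · exact limsup_le_of_le (hcob t).isCoboundedUnder_le
        (Eventually.of_forall fun n => (abs_le.1 (hb n t)).2)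
  have hui : ∀ n, Integrable (u n) μ := fun n =>
    hg.mono' (hu n).aestronglyMeasurable (Eventually.of_forall (hb n))
  have hMi : Integrable M μ := hg.mono' hMm.aestronglyMeasurable (Eventually.of_forall hMg)
  -- The positive part of `u n - M` vanishes pointwise by the definition of the upper limit. With
  -- `|v| = 2 * max v 0 - v` and `∫ M ≤ c` this gives convergence in mean.
  have hpos : Tendsto (fun n => ∫ t, max (u n t - M t) 0 ∂μ) atTop (𝓝 0) := by
    have h := tendsto_integral_of_dominated_convergence (μ := μ) (f := fun _ => (0 : ℝ))
      (F := fun n t => max (u n t - M t) 0) (fun t => 2 * g t)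
      (fun n => (((hu n).sub hMm).max measurable_const).aestronglyMeasurable)
      (hg.const_mul 2) (fun n => Eventually.of_forall fun t => ?_)
      (Eventually.of_forall fun t => ?_)
    · simpa using h
    · have h1 := abs_le.1 (hb n t)
      have h2 := abs_le.1 (hMg t)
      rw [Real.norm_of_nonneg (le_max_right _ _)]
      exact max_le (by linarith) (by linarith)
    · refine tendsto_order.2 ⟨fun a ha => Eventually.of_forall fun n =>
        ha.trans_le (le_max_right _ _), fun a ha => ?_⟩
      have h1 : limsup (fun n => u n t) atTop < M t + a := lt_add_of_pos_right _ ha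
      filter_upwards [eventually_lt_of_limsup_lt h1 (hbdd t)] with n hn
      exact max_lt (by linarith) ha
  have habs : ∀ n, ∫ t, |u n t - M t| ∂μ
      = 2 * ∫ t, max (u n t - M t) 0 ∂μ - (∫ t, u n t ∂μ - ∫ t, M t ∂μ) := by
    intro n
    have hmi : Integrable (fun t => max (u n t - M t) 0) μ := ((hui n).sub hMi).pos_part
    rw [← integral_sub (hui n) hMi, ← integral_const_mul,
      ← integral_sub (hmi.const_mul 2) (g := fun t => u n t - M t) ((hui n).sub hMi)]
    refine integral_congr_ae (Eventually.of_forall fun t => ?_)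
    beta_reduce
    rcases le_total (u n t - M t) 0 with h | h
    · rw [abs_of_nonpos h, max_eq_right h]; ring
    · rw [abs_of_nonneg h, max_eq_left h]; ring
  have hlim : Tendsto (fun n => ∫ t, |u n t - M t| ∂μ) atTop (𝓝 (2 * 0 - (c - ∫ t, M t ∂μ))) := by
    simp_rw [habs]
    exact (hpos.const_mul 2).sub (hc.sub_const _)
  have hnn : 0 ≤ 2 * 0 - (c - ∫ t, M t ∂μ) :=
    ge_of_tendsto' hlim fun n => integral_nonneg fun t => abs_nonneg _
  have hz : 2 * 0 - (c - ∫ t, M t ∂μ) = 0 := le_antisymm (by linarith) hnn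
  rw [hz] at hlim
  have hL1 : Tendsto (fun n => eLpNorm (u n - M) 1 μ) atTop (𝓝 0) := by
    have h := ENNReal.tendsto_ofReal hlim
    rw [ENNReal.ofReal_zero] at h
    refine h.congr fun n => ?_
    rw [eLpNorm_one_eq_lintegral_enorm, ← ofReal_integral_norm_eq_lintegral_enorm
      ((hui n).sub hMi)]
    rfl
  exact (tendstoInMeasure_of_tendsto_eLpNorm one_ne_zero
    (fun n => (hu n).aestronglyMeasurable) hMm.aestronglyMeasurable hL1).exists_seq_tendsto_ae

variable {ι : Type*} [Fintype ι]

/-- The integrals of the selections of a bounded correspondence form a convex set. -/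
lemma convex_integral_selections (ν : Measure ℝ) [IsFiniteMeasure ν] [NullSingletonClass ν]
    (K : ℝ → Set (EuclideanSpace ℝ ι)) {g : ℝ → ℝ} (hg : Integrable g ν)
    (hK : ∀ t, ∀ y ∈ K t, ‖y‖ ≤ g t) :
    Convex ℝ {z | ∃ F : ℝ → EuclideanSpace ℝ ι, Measurable F ∧ (∀ᵐ t ∂ν, F t ∈ K t) ∧
      ∫ t, F t ∂ν = z} := by
  classical
  rintro _ ⟨F, hF, hFK, rfl⟩ _ ⟨F', hF', hFK', rfl⟩ a b ha hb hab
  have hi : ∀ {F : ℝ → EuclideanSpace ℝ ι}, Measurable F → (∀ᵐ t ∂ν, F t ∈ K t) →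
      Integrable F ν := fun hF hFK =>
    hg.mono' hF.aestronglyMeasurable (hFK.mono fun t ht => hK t _ ht)
  have hd := (hi hF hFK).sub (hi hF' hFK')
  -- `A` carries the fraction `a` of the integral of `F - F'`, so `F` on `A` glued to `F'` off `A`
  -- realises the convex combination.
  obtain ⟨A, hA, hAs⟩ := exists_setIntegral_eq_smul ν hd ⟨ha, by linarith⟩
  refine ⟨fun t => F' t + A.indicator (F - F') t, hF'.add ((hF.sub hF').indicator hA), ?_, ?_⟩
  · filter_upwards [hFK, hFK'] with t h h'
    by_cases htA : t ∈ A
    · simpa [htA] using h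
    · simpa [htA] using h'
  · rw [integral_add (hi hF' hFK') (hd.indicator hA), integral_indicator hA, hAs]
    simp only [Pi.sub_apply]
    rw [integral_sub (hi hF hFK) (hi hF' hFK'), eq_sub_of_add_eq' hab]
    module

/-- Fatou's lemma in finite dimension for a measure without point masses, assuming that the
sequence already converges almost everywhere in all directions of a subspace `L`. -/
lemma exists_selection_of_tendsto_directions (ν : Measure ℝ) [IsFiniteMeasure ν]
    [NullSingletonClass ν] {g : ℝ → ℝ} (hg : Integrable g ν) {x : EuclideanSpace ℝ ι}
    (L : Submodule ℝ (EuclideanSpace ℝ ι)) :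
    ∀ f : ℕ → ℝ → EuclideanSpace ℝ ι, (∀ n, Measurable (f n)) → (∀ n t, ‖f n t‖ ≤ g t) →
      Tendsto (fun n => ∫ t, f n t ∂ν) atTop (𝓝 x) →
      (∀ w ∈ L, ∀ᵐ t ∂ν, ∃ c, Tendsto (fun n => inner ℝ w (f n t)) atTop (𝓝 c)) →
      ∃ F : ℝ → EuclideanSpace ℝ ι, Measurable F ∧
        (∀ᵐ t ∂ν, F t ∈ {y | MapClusterPt y atTop fun n => f n t}) ∧ ∫ t, F t ∂ν = x := by
  -- Ascending induction: failure at `L` yields a new direction in which a subsequence converges. At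
  -- `⊤` there is no nonzero vector left in `Lᗮ`, so failure is impossible.
  induction L using WellFoundedGT.induction with
  | ind L ih =>
  intro f hf hb hx hL
  have hfi : ∀ n, Integrable (f n) ν := fun n =>
    hg.mono' (hf n).aestronglyMeasurable (Eventually.of_forall (hb n))
  have hinner : ∀ w, Tendsto (fun n => ∫ t, inner ℝ w (f n t) ∂ν) atTop (𝓝 (inner ℝ w x)) := by
    intro w
    refine (tendsto_const_nhds.inner hx).congr fun n => ?_
    exact (integral_inner (hfi n) w).symm
  have hKb : ∀ t, ∀ y ∈ {y | MapClusterPt y atTop fun n => f n t}, ‖y‖ ≤ g t :=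
    fun t y hy => MapClusterPt.norm_le hy fun n => hb n t
  set A := {z | ∃ F : ℝ → EuclideanSpace ℝ ι, Measurable F ∧
    (∀ᵐ t ∂ν, F t ∈ {y | MapClusterPt y atTop fun n => f n t}) ∧ ∫ t, F t ∂ν = z} with hAdef
  have hAconv : Convex ℝ A := convex_integral_selections ν _ hg hKb
  have hFi : ∀ {F : ℝ → EuclideanSpace ℝ ι}, Measurable F →
      (∀ᵐ t ∂ν, F t ∈ {y | MapClusterPt y atTop fun n => f n t}) → Integrable F ν :=
    fun hF hFK => hg.mono' hF.aestronglyMeasurable (hFK.mono fun t ht => hKb t _ ht)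
  by_contra hxA
  change x ∉ A at hxA
  set C := (fun z => x + z) ⁻¹' A with hC
  have hCconv : Convex ℝ C := hAconv.translate_preimage_right x
  have hsel : ∀ p, ∃ F : ℝ → EuclideanSpace ℝ ι, ∫ t, F t ∂ν ∈ A ∧ Integrable F ν ∧
      ∀ t, inner ℝ p (F t) = limsup (fun n => inner ℝ p (f n t)) atTop := by
    intro p
    obtain ⟨F, hF, hFK⟩ := exists_measurable_mapClusterPt hf hb p
    have h : ∀ᵐ t ∂ν, F t ∈ {y | MapClusterPt y atTop fun n => f n t} :=
      Eventually.of_forall fun t => (hFK t).1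
    exact ⟨F, ⟨F, hF, h, rfl⟩, hFi hF h, fun t => (hFK t).2⟩
  have hCne : C.Nonempty := by
    obtain ⟨F, hF, -⟩ := hsel 0
    exact ⟨∫ t, F t ∂ν - x, by simpa [hC] using hF⟩
  have hC0 : (0 : EuclideanSpace ℝ ι) ∉ C := by simpa [hC] using hxA
  -- In directions of `L` the sequence converges, so the integral of any selection of cluster points
  -- agrees there with `x`.
  have hCL : C ⊆ (Lᗮ : Submodule ℝ (EuclideanSpace ℝ ι)) := by
    rintro z ⟨F, hF, hFK, hFz⟩
    refine (Submodule.mem_orthogonal L z).2 fun w hw => ?_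
    have h1 : Tendsto (fun n => ∫ t, inner ℝ w (f n t) ∂ν) atTop
        (𝓝 (∫ t, inner ℝ w (F t) ∂ν)) := by
      refine tendsto_integral_of_dominated_convergence (fun t => ‖w‖ * g t)
        (fun n => (measurable_const.inner (hf n)).aestronglyMeasurable) (hg.const_mul _)
        (fun n => Eventually.of_forall fun t => ?_) ?_
      · exact (norm_inner_le_norm _ _).trans
          (mul_le_mul_of_nonneg_left (hb n t) (norm_nonneg _))
      · filter_upwards [hL w hw, hFK] with t ⟨c, hc⟩ hFt
        rwa [MapClusterPt.eq_of_tendsto hFt (φ := fun y => inner ℝ w y) (by fun_prop) hc]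
    have h2 := tendsto_nhds_unique h1 (hinner w)
    rw [integral_inner (hFi hF hFK), hFz, inner_add_right] at h2
    linarith
  obtain ⟨p, hpL, hp0, hp⟩ := hCconv.exists_mem_submodule_inner_nonpos hCne hC0 hCL
  obtain ⟨F, hFA, hFint, hFp⟩ := hsel p
  -- Separation is tested on the selection attaining the upper limit in direction `p`; this is what
  -- `exists_subseq_tendsto_limsup` requires.
  have hle : ∫ t, limsup (fun n => inner ℝ p (f n t)) atTop ∂ν ≤ inner ℝ p x := by
    have h1 := hp (∫ t, F t ∂ν - x) (by simpa [hC] using hFA)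
    rw [inner_sub_right, ← integral_inner hFint] at h1
    simp only [hFp] at h1
    linarith
  obtain ⟨φ, hφ, hconv⟩ := exists_subseq_tendsto_limsup
    (fun n => measurable_const.inner (hf n)) (hg.const_mul ‖p‖)
    (fun n t => (abs_real_inner_le_norm _ _).trans
      (mul_le_mul_of_nonneg_left (hb n t) (norm_nonneg _))) (hinner p) hle
  have hlt : L < L ⊔ Submodule.span ℝ {p} := by
    refine left_lt_sup.2 fun h => hp0 ?_
    have hpm : p ∈ L := h (Submodule.mem_span_singleton_self p)
    exact inner_self_eq_zero.1 (Submodule.inner_right_of_mem_orthogonal hpm hpL)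
  obtain ⟨F', hF', hF'K, hF'x⟩ := ih _ hlt (fun n => f (φ n)) (fun n => hf _) (fun n => hb _)
    (hx.comp hφ.tendsto_atTop) (by
      intro w hw
      obtain ⟨v, hv, q, hq, rfl⟩ := Submodule.mem_sup.1 hw
      obtain ⟨r, rfl⟩ := Submodule.mem_span_singleton.1 hq
      filter_upwards [hL v hv, hconv] with t ⟨c, hc⟩ ht
      refine ⟨_, ((hc.comp hφ.tendsto_atTop).add (ht.const_mul r)).congr fun n => ?_⟩
      simp [inner_add_left, inner_smul_left])
  refine hxA ⟨F', hF', hF'K.mono fun t ht => ?_, hF'x⟩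
  exact MapClusterPt.of_comp hφ.tendsto_atTop ht

/-- Fatou's lemma in finite dimension on the real line. -/
lemma exists_selection_of_tendsto_integral_real (ν : Measure ℝ) [IsFiniteMeasure ν]
    {g : ℝ → ℝ} (hg : Integrable g ν) {x : EuclideanSpace ℝ ι}
    {f : ℕ → ℝ → EuclideanSpace ℝ ι} (hf : ∀ n, Measurable (f n)) (hb : ∀ n t, ‖f n t‖ ≤ g t)
    (hx : Tendsto (fun n => ∫ t, f n t ∂ν) atTop (𝓝 x)) :
    ∃ F : ℝ → EuclideanSpace ℝ ι, Measurable F ∧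
      (∀ᵐ t ∂ν, MapClusterPt (F t) atTop fun n => f n t) ∧ ∫ t, F t ∂ν = x := by
  classical
  set S : Set ℝ := {t | 0 < ν {t}} with hS
  have hSc : S.Countable := Measure.countable_meas_pos_of_disjoint_iUnion
    (fun t => measurableSet_singleton t) fun s t hst => by simpa using hst
  have hSm : MeasurableSet S := hSc.measurableSet
  have : Countable S := hSc.to_subtype
  have : NullSingletonClass (ν.restrict Sᶜ) := by
    refine ⟨fun t => ?_⟩
    rw [Measure.restrict_apply (measurableSet_singleton t)]
    by_cases ht : t ∈ S
    · rw [(disjoint_singleton_left.2 fun h => h ht : Disjoint {t} Sᶜ).inter_eq, measure_empty]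
    · exact measure_mono_null inter_subset_left (nonpos_iff_eq_zero.1 (not_lt.1 ht))
  -- As `S` is countable, one subsequence converges at all atoms simultaneously.
  obtain ⟨c, -, φ, hφ, hc⟩ := (isCompact_univ_pi fun t : S =>
    isCompact_closedBall (0 : EuclideanSpace ℝ ι) (g t)).tendsto_subseq
    (x := fun n (t : S) => f n t) (fun n t _ => by simpa using hb n t)
  have hfi : ∀ n, Integrable (f n) ν := fun n =>
    hg.mono' (hf n).aestronglyMeasurable (Eventually.of_forall (hb n))
  set F₀ : ℝ → EuclideanSpace ℝ ι := fun t => if h : t ∈ S then c ⟨t, h⟩ else 0 with hF₀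
  have hlim : ∀ t, Tendsto (fun n => S.indicator (f (φ n)) t) atTop (𝓝 (F₀ t)) := by
    intro t
    by_cases ht : t ∈ S
    · simpa [hF₀, ht] using (tendsto_pi_nhds.1 hc) ⟨t, ht⟩
    · simp [hF₀, ht]
  have hF₀m : Measurable F₀ :=
    measurable_of_tendsto_metrizable (fun n => (hf _).indicator hSm) (tendsto_pi_nhds.2 hlim)
  have hF₀lim : Tendsto (fun n => ∫ t, S.indicator (f (φ n)) t ∂ν) atTop
      (𝓝 (∫ t, F₀ t ∂ν)) :=
    tendsto_integral_of_dominated_convergence g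
      (fun n => ((hf _).indicator hSm).aestronglyMeasurable) hg
      (fun n => Eventually.of_forall fun t => (norm_indicator_le_norm_self _ _).trans (hb _ t))
      (Eventually.of_forall hlim)
  have hrest : Tendsto (fun n => ∫ t, f (φ n) t ∂(ν.restrict Sᶜ)) atTop
      (𝓝 (x - ∫ t, F₀ t ∂ν)) := by
    refine ((hx.comp hφ.tendsto_atTop).sub hF₀lim).congr fun n => ?_
    rw [integral_indicator hSm]
    exact sub_eq_of_eq_add' (integral_add_compl hSm (hfi _)).symm
  obtain ⟨F₁, hF₁m, hF₁, hF₁x⟩ := exists_selection_of_tendsto_directions (ν.restrict Sᶜ)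
    hg.integrableOn (x := x - ∫ t, F₀ t ∂ν) ⊥ (fun n => f (φ n)) (fun n => hf _) (fun n => hb _)
    hrest (by
      intro w hw
      rw [(Submodule.mem_bot ℝ).1 hw]
      exact Eventually.of_forall fun t => ⟨0, by simp⟩)
  have hF₁i : Integrable F₁ (ν.restrict Sᶜ) := hg.integrableOn.mono' hF₁m.aestronglyMeasurable
    (hF₁.mono fun t ht => MapClusterPt.norm_le ht fun n => hb _ t)
  have hF₀i : Integrable F₀ ν := hg.mono' hF₀m.aestronglyMeasurable
    (Eventually.of_forall fun t => le_of_tendsto' (hlim t).norm fun n =>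
      (norm_indicator_le_norm_self _ _).trans (hb _ t))
  refine ⟨fun t => F₀ t + Sᶜ.indicator F₁ t, hF₀m.add (hF₁m.indicator hSm.compl), ?_, ?_⟩
  · filter_upwards [(ae_restrict_iff' hSm.compl).1 hF₁] with t ht
    refine MapClusterPt.of_comp hφ.tendsto_atTop ?_
    by_cases htS : t ∈ S
    · have h1 := (tendsto_pi_nhds.1 hc) ⟨t, htS⟩
      simpa [hF₀, htS] using! h1.mapClusterPt
    · simpa [hF₀, htS, Function.comp_def] using ht htS
  · rw [integral_add hF₀i ((integrable_indicator_iff hSm.compl).2 hF₁i),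
      integral_indicator hSm.compl, hF₁x]
    abel

/-- **Fatou's lemma in finite dimension** for dominated sequences: a limit of the integrals is the
integral of a selection of pointwise cluster points. -/
theorem exists_selection_of_tendsto_integral {T : Type*} [MeasurableSpace T] {μ : Measure T}
    [IsFiniteMeasure μ] {g : T → ℝ} (hg : Integrable g μ) {x : EuclideanSpace ℝ ι}
    {f : ℕ → T → EuclideanSpace ℝ ι} (hf : ∀ n, AEStronglyMeasurable (f n) μ)
    (hb : ∀ n, ∀ᵐ t ∂μ, ‖f n t‖ ≤ g t)
    (hx : Tendsto (fun n => ∫ t, f n t ∂μ) atTop (𝓝 x)) :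
    ∃ F : T → EuclideanSpace ℝ ι, Integrable F μ ∧
      (∀ᵐ t ∂μ, MapClusterPt (F t) atTop fun n => f n t) ∧ ∫ t, F t ∂μ = x := by
  classical
  -- The bound and the whole sequence are coded by one map into a Polish space, which embeds
  -- measurably into `ℝ`. The problem is solved for the law `μ.map ψ` and pulled back along `ψ`.
  set θ : T → ℝ × (ℕ → EuclideanSpace ℝ ι) :=
    fun t => (hg.aestronglyMeasurable.mk g t, fun n => (hf n).mk (f n) t) with hθ
  have hθm : Measurable θ := hg.aestronglyMeasurable.stronglyMeasurable_mk.measurable.prodMk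
    (measurable_pi_lambda _ fun n => (hf n).stronglyMeasurable_mk.measurable)
  have he := measurableEmbedding_embeddingReal (ℝ × (ℕ → EuclideanSpace ℝ ι))
  set e := embeddingReal (ℝ × (ℕ → EuclideanSpace ℝ ι))
  obtain ⟨r, hrm, hre⟩ := he.exists_measurable_extend measurable_id fun _ => inferInstance
  have hr : ∀ y, r (e y) = y := fun y => congr_fun hre y
  set ψ : T → ℝ := fun t => e (θ t) with hψ
  have hψm : Measurable ψ := he.measurable.comp hθm
  set G : ℝ → ℝ := fun s => |(r s).1| with hG
  have hGm : Measurable G := hrm.fst.abs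
  have hcm : ∀ n, Measurable fun s => (r s).2 n := fun n =>
    (measurable_pi_apply n).comp hrm.snd
  -- The bounds are known only almost everywhere; cutting off outside `B` makes them hold
  -- everywhere.
  set B : Set ℝ := {s | ∀ n, ‖(r s).2 n‖ ≤ G s} with hB
  have hBm : MeasurableSet B := by
    rw [hB, ofPred_forall]
    exact MeasurableSet.iInter fun n => measurableSet_le (hcm n).norm hGm
  set k : ℕ → ℝ → EuclideanSpace ℝ ι := fun n => B.indicator fun s => (r s).2 n with hk
  have hkm : ∀ n, Measurable (k n) := fun n => (hcm n).indicator hBm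
  have hkb : ∀ n s, ‖k n s‖ ≤ G s := by
    intro n s
    by_cases hs : s ∈ B
    · simpa [hk, hs] using hs n
    · simpa [hk, hs] using abs_nonneg _
  have hGψ : ∀ᵐ t ∂μ, G (ψ t) = |g t| := by
    filter_upwards [hg.aestronglyMeasurable.ae_eq_mk] with t ht
    simp only [hG, hψ, hr, hθ, ← ht]
  have hkψ : ∀ᵐ t ∂μ, ∀ n, k n (ψ t) = f n t := by
    filter_upwards [hGψ, ae_all_iff.2 fun n => (hf n).ae_eq_mk, ae_all_iff.2 hb] with t h1 h2 h3 n
    have h4 : ∀ n, (r (ψ t)).2 n = f n t := fun n => by simp only [hψ, hr, hθ, ← h2 n]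
    have h5 : ψ t ∈ B := fun n => by
      rw [h4, h1]
      exact (h3 n).trans (le_abs_self _)
    simp only [hk, indicator_of_mem h5, h4]
  have hGi : Integrable G (μ.map ψ) :=
    (integrable_map_measure hGm.aestronglyMeasurable hψm.aemeasurable).2
      (hg.abs.congr (hGψ.mono fun t ht => ht.symm))
  have hkx : Tendsto (fun n => ∫ s, k n s ∂(μ.map ψ)) atTop (𝓝 x) := by
    refine hx.congr fun n => ?_
    rw [integral_map hψm.aemeasurable (hkm n).aestronglyMeasurable]
    exact integral_congr_ae (hkψ.mono fun t ht => (ht n).symm)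
  obtain ⟨F, hFm, hFc, hFx⟩ := exists_selection_of_tendsto_integral_real (μ.map ψ) hGi hkm hkb hkx
  have hFi : Integrable F (μ.map ψ) := hGi.mono' hFm.aestronglyMeasurable
    (hFc.mono fun s hs => MapClusterPt.norm_le hs fun n => hkb n s)
  refine ⟨fun t => F (ψ t), hFi.comp_measurable hψm, ?_, ?_⟩
  · filter_upwards [ae_of_ae_map hψm.aemeasurable hFc, hkψ] with t h1 h2
    simpa only [h2] using h1
  · rw [← hFx, integral_map hψm.aemeasurable hFm.aestronglyMeasurable]

end Fatou

/-! ### Hausdorff continuity along sequences. -/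

section HausdorffContinuity

/-- A sequential criterion for Hausdorff continuity. -/
lemma DiffInfoEconomy.hausdorffContinuous_of_seq {G : Type*} [TopologicalSpace G]
    [SequentialSpace G] {ℓ : ℕ} {F : G → Set (DiffInfoEconomy.Commodity ℓ)}
    (hne : ∀ p, (F p).Nonempty)
    (hupper : ∀ (q : ℕ → G) (p : G), Tendsto q atTop (𝓝 p) →
      ∀ z : ℕ → DiffInfoEconomy.Commodity ℓ, (∀ n, z n ∈ F (q n)) →
      ∃ y ∈ F p, ∃ φ : ℕ → ℕ, StrictMono φ ∧ Tendsto (z ∘ φ) atTop (𝓝 y))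
    (hlower : ∀ (q : ℕ → G) (p : G), Tendsto q atTop (𝓝 p) → ∀ y ∈ F p,
      ∃ z : ℕ → DiffInfoEconomy.Commodity ℓ, (∀ n, z n ∈ F (q n)) ∧ Tendsto z atTop (𝓝 y)) :
    DiffInfoEconomy.HausdorffContinuous F := by
  have hcpt : ∀ p, IsCompact (F p) := fun p => by
    refine IsSeqCompact.isCompact fun z hz => ?_
    exact hupper (fun _ => p) p tendsto_const_nhds z hz
  refine ⟨fun p => ⟨⟨F p, hcpt p⟩, hne p⟩, fun p => rfl, ?_⟩
  refine continuous_iff_seqContinuous.2 fun q p hq => ?_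
  refine Metric.tendsto_nhds.2 fun ε hε => ?_
  have h1 : ∀ᶠ n in atTop, ∀ z ∈ F (q n), Metric.infDist z (F p) ≤ ε / 2 := by
    by_contra hcon
    obtain ⟨φ, hφ, hbad⟩ := extraction_of_frequently_atTop (not_eventually.1 hcon)
    push Not at hbad
    choose z hz hzε using hbad
    obtain ⟨y, hy, ψ, hψ, hlim⟩ := hupper _ p (hq.comp hφ.tendsto_atTop) z hz
    obtain ⟨n, hn⟩ := ((tendsto_iff_dist_tendsto_zero.1 hlim).eventually
      (gt_mem_nhds (half_pos hε))).exists
    exact absurd ((Metric.infDist_le_dist_of_mem hy).trans_lt hn) (not_lt.2 (hzε (ψ n)).le)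
  have h2 : ∀ᶠ n in atTop, ∀ z ∈ F p, Metric.infDist z (F (q n)) ≤ ε / 2 := by
    by_contra hcon
    obtain ⟨φ, hφ, hbad⟩ := extraction_of_frequently_atTop (not_eventually.1 hcon)
    push Not at hbad
    choose z hz hzε using hbad
    obtain ⟨y, hy, ψ, hψ, hlim⟩ := (hcpt p).tendsto_subseq hz
    obtain ⟨w, hw, hwlim⟩ := hlower _ p (hq.comp (hφ.comp hψ).tendsto_atTop) y hy
    have hd : Tendsto (fun n => dist (z (ψ n)) (w n)) atTop (𝓝 0) := by
      simpa using hlim.dist hwlim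
    obtain ⟨n, hn⟩ := (hd.eventually (gt_mem_nhds (half_pos hε))).exists
    exact absurd ((Metric.infDist_le_dist_of_mem (hw n)).trans_lt hn) (not_lt.2 (hzε (ψ n)).le)
  filter_upwards [h1, h2] with n hn1 hn2
  rw [Metric.NonemptyCompacts.dist_eq]
  exact (Metric.hausdorffDist_le_of_infDist (half_pos hε).le hn1 hn2).trans_lt (half_lt_self hε)

end HausdorffContinuity

namespace DiffInfoEconomy

/-! ### Prices and bundles. -/

section Prices

variable {ℓ : ℕ} {p x y : Commodity ℓ}

lemma inner_eq_sum (p x : Commodity ℓ) : inner ℝ p x = ∑ h, p h * x h := by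
  simp [PiLp.inner_apply, mul_comm]

lemma nonempty_of_mem_priceSimplex (hp : p ∈ priceSimplex ℓ) : Nonempty (Fin ℓ) := by
  by_contra h
  rw [not_nonempty_iff] at h
  simpa using hp.2

lemma minPrice_le (p : Commodity ℓ) (h : Fin ℓ) : minPrice p ≤ p h :=
  ciInf_le (finite_range _).bddBelow h

lemma minPrice_pos (hp : p ∈ priceSimplex ℓ) : 0 < minPrice p := by
  have := nonempty_of_mem_priceSimplex hp
  obtain ⟨h, hh⟩ := exists_eq_ciInf_of_finite (f := fun h => p h)
  rw [minPrice, ← hh]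
  exact hp.1 h

lemma continuous_minPrice [Nonempty (Fin ℓ)] : Continuous (minPrice : Commodity ℓ → ℝ) := by
  have h : (minPrice : Commodity ℓ → ℝ) =
      fun p => Finset.univ.inf' Finset.univ_nonempty fun h => p h :=
    funext fun p => (Finset.inf'_univ_eq_ciInf fun h => p h).symm
  rw [h]
  exact Continuous.finset_inf'_apply _ fun h _ => (EuclideanSpace.proj (𝕜 := ℝ) h).continuous

lemma price_le_one (hp : p ∈ priceSimplex ℓ) (h : Fin ℓ) : p h ≤ 1 := by
  rw [← hp.2]
  exact Finset.single_le_sum (f := fun h => p h) (fun i _ => (hp.1 i).le) (Finset.mem_univ h)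

lemma isClosed_consumptionSet : IsClosed (consumptionSet ℓ) := by
  rw [consumptionSet, ofPred_forall]
  exact isClosed_iInter fun h =>
    isClosed_le continuous_const (EuclideanSpace.proj (𝕜 := ℝ) h).continuous

lemma inner_nonneg_of_mem (hp : p ∈ priceSimplex ℓ) (hx : x ∈ consumptionSet ℓ) :
    0 ≤ inner ℝ p x := by
  rw [inner_eq_sum]
  exact Finset.sum_nonneg fun h _ => mul_nonneg (hp.1 h).le (hx h)

lemma mul_le_inner (hp : p ∈ priceSimplex ℓ) (hx : x ∈ consumptionSet ℓ) (h : Fin ℓ) :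
    p h * x h ≤ inner ℝ p x := by
  rw [inner_eq_sum]
  exact Finset.single_le_sum (f := fun h => p h * x h)
    (fun i _ => mul_nonneg (hp.1 i).le (hx i)) (Finset.mem_univ h)

lemma eq_zero_of_inner_nonpos (hp : p ∈ priceSimplex ℓ) (hx : x ∈ consumptionSet ℓ)
    (h : inner ℝ p x ≤ 0) : x = 0 := by
  ext i
  have h1 := (mul_le_inner hp hx i).trans h
  exact le_antisymm (nonpos_of_mul_nonpos_right h1 (hp.1 i)) (hx i)

lemma inner_le_sum (hp : p ∈ priceSimplex ℓ) (hx : x ∈ consumptionSet ℓ) :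
    inner ℝ p x ≤ ∑ h, x h := by
  rw [inner_eq_sum]
  exact Finset.sum_le_sum fun h _ => mul_le_of_le_one_left (hx h) (price_le_one hp h)

/-- The bundle containing the quantity `c` of each commodity. -/
noncomputable def uniformBundle (ℓ : ℕ) (c : ℝ) : Commodity ℓ := WithLp.toLp 2 fun _ => c

@[simp]
lemma uniformBundle_apply (c : ℝ) (h : Fin ℓ) : uniformBundle ℓ c h = c := rfl

lemma uniformBundle_eq_smul (c : ℝ) : uniformBundle ℓ c = c • uniformBundle ℓ 1 := by
  ext h
  simp

lemma norm_le_mul_of_mem_consumptionSet {c : ℝ} (hc : 0 ≤ c) (hx : x ∈ consumptionSet ℓ)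
    (hxc : ∀ h, x h ≤ c) :
    ‖x‖ ≤ c * ‖uniformBundle ℓ 1‖ := by
  have h1 : ‖x‖ ≤ ‖uniformBundle ℓ c‖ := by
    rw [EuclideanSpace.norm_eq, EuclideanSpace.norm_eq]
    refine Real.sqrt_le_sqrt (Finset.sum_le_sum fun h _ => ?_)
    rw [uniformBundle_apply, Real.norm_of_nonneg (hx h), Real.norm_of_nonneg hc]
    exact pow_le_pow_left₀ (hx h) (hxc h) 2
  rwa [uniformBundle_eq_smul, norm_smul, Real.norm_of_nonneg hc] at h1

/-- The coordinatewise positive part. -/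
noncomputable def posPart (x : Commodity ℓ) : Commodity ℓ := WithLp.toLp 2 fun h => max (x h) 0

lemma posPart_mem (x : Commodity ℓ) : posPart x ∈ consumptionSet ℓ := fun _ => le_max_right _ _

lemma posPart_eq_self (hx : x ∈ consumptionSet ℓ) : posPart x = x := by
  ext h
  exact max_eq_left (hx h)

lemma continuous_posPart : Continuous (posPart : Commodity ℓ → Commodity ℓ) :=
  (PiLp.continuous_toLp 2 _).comp (continuous_pi fun h =>
    (EuclideanSpace.proj (𝕜 := ℝ) h).continuous.max continuous_const)

end Prices

/-! ### Budget sets and preferred sets of one agent. -/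

section Economy

variable {T Ω : Type*} {ℓ : ℕ} {a : T → Ω → Commodity ℓ} {U : T → Ω → Commodity ℓ → ℝ}
  {t : T} {ω : Ω} {p x y : Commodity ℓ}

lemma sum_endowment_nonneg (ha : a t ω ∈ consumptionSet ℓ) : 0 ≤ ∑ h, a t ω h :=
  Finset.sum_nonneg fun h _ => ha h

lemma gammaBound_nonneg (hp : p ∈ priceSimplex ℓ) (ha : a t ω ∈ consumptionSet ℓ) :
    0 ≤ gammaBound a t ω p :=
  mul_nonneg (one_div_nonneg.2 (minPrice_pos hp).le) (sum_endowment_nonneg ha)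

/-- A unit of any commodity costs at least `minPrice p`, and income is at most the total endowment
because prices do not exceed `1`. -/
lemma budget_subset_truncation (hp : p ∈ priceSimplex ℓ) (ha : a t ω ∈ consumptionSet ℓ) :
    budget a t ω p ⊆ truncation a t ω p := by
  rintro x ⟨hx, hxp⟩
  refine ⟨hx, fun h => ?_⟩
  rw [gammaBound, one_div, inv_mul_eq_div, le_div_iff₀ (minPrice_pos hp)]
  calc x h * minPrice p ≤ x h * p h := mul_le_mul_of_nonneg_left (minPrice_le p h) (hx h)
    _ = p h * x h := mul_comm _ _
    _ ≤ inner ℝ p x := mul_le_inner hp hx h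
    _ ≤ inner ℝ p (a t ω) := hxp
    _ ≤ ∑ h, a t ω h := inner_le_sum hp ha

lemma AssumptionA3.lt_of_le_of_ne (hU : AssumptionA3 U) (hx : x ∈ consumptionSet ℓ)
    (hxy : ∀ h, x h ≤ y h) (hne : x ≠ y) : U t ω x < U t ω y := by
  have h1 := hU t ω x hx (y - x) (fun h => by simpa using hxy h) (sub_ne_zero.2 hne.symm)
  rwa [add_sub_cancel] at h1

lemma AssumptionA3.monotone (hU : AssumptionA3 U) (hx : x ∈ consumptionSet ℓ)
    (hxy : ∀ h, x h ≤ y h) : U t ω x ≤ U t ω y := by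
  rcases eq_or_ne x y with rfl | hne
  · exact le_rfl
  · exact (hU.lt_of_le_of_ne hx hxy hne).le

lemma uniformBundle_mem_preferredSet (hp : p ∈ priceSimplex ℓ) (ha : a t ω ∈ consumptionSet ℓ)
    (hU : AssumptionA3 U) : uniformBundle ℓ (gammaBound a t ω p) ∈ preferredSet a U t ω p := by
  have hmem : uniformBundle ℓ (gammaBound a t ω p) ∈ consumptionSet ℓ :=
    fun _ => gammaBound_nonneg hp ha
  exact ⟨⟨hmem, fun x hx => hU.monotone hx.1 (budget_subset_truncation hp ha hx).2⟩,
    hmem, fun _ => le_rfl⟩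

/-- Utility is controlled on the cone only; the retraction `posPart` extends it continuously to the
whole space. -/
lemma continuous_utility_posPart [MeasurableSpace T] [MeasurableSpace Ω] (hU : AssumptionA2 U)
    (t : T) (ω : Ω) : Continuous fun x => U t ω (posPart x) :=
  (hU.2 t ω).comp_continuous continuous_posPart posPart_mem

lemma tendsto_utility [MeasurableSpace T] [MeasurableSpace Ω] (hU : AssumptionA2 U)
    {α : Type*} {l : Filter α} {u : α → Commodity ℓ}
    (hu : ∀ n, u n ∈ consumptionSet ℓ) (hx : x ∈ consumptionSet ℓ) (hlim : Tendsto u l (𝓝 x)) :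
    Tendsto (fun n => U t ω (u n)) l (𝓝 (U t ω x)) := by
  have h := ((continuous_utility_posPart hU t ω).tendsto x).comp hlim
  rw [posPart_eq_self hx] at h
  exact h.congr fun n => by simp [posPart_eq_self (hu n)]

lemma tendsto_gammaBound {q : ℕ → Commodity ℓ} (hp : p ∈ priceSimplex ℓ)
    (hq : Tendsto q atTop (𝓝 p)) :
    Tendsto (fun n => gammaBound a t ω (q n)) atTop (𝓝 (gammaBound a t ω p)) := by
  have := nonempty_of_mem_priceSimplex hp
  have h1 : Tendsto (fun n => minPrice (q n)) atTop (𝓝 (minPrice p)) :=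
    (continuous_minPrice.tendsto p).comp hq
  exact (tendsto_const_nhds.div h1 (minPrice_pos hp).ne').mul_const _

/-- Affordable bundles are limits of affordable bundles at nearby prices. -/
lemma exists_seq_mem_budget {q : ℕ → Commodity ℓ} (hp : p ∈ priceSimplex ℓ)
    (hqs : ∀ n, q n ∈ priceSimplex ℓ) (hq : Tendsto q atTop (𝓝 p))
    (ha : a t ω ∈ consumptionSet ℓ) (hx : x ∈ budget a t ω p) :
    ∃ u : ℕ → Commodity ℓ, (∀ n, u n ∈ budget a t ω (q n)) ∧ Tendsto u atTop (𝓝 x) := by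
  rcases eq_or_ne x 0 with rfl | hx0
  · refine ⟨fun _ => 0, fun n => ⟨hx.1, ?_⟩, tendsto_const_nhds⟩
    rw [inner_zero_right]
    exact inner_nonneg_of_mem (hqs n) ha
  have hpos : ∀ {r : Commodity ℓ}, r ∈ priceSimplex ℓ → 0 < inner ℝ r x := fun hr =>
    not_le.1 fun h => hx0 (eq_zero_of_inner_nonpos hr hx.1 h)
  have hpa : 0 < inner ℝ p (a t ω) := (hpos hp).trans_le hx.2
  -- The factor makes `s n • x` spend at `q n` the same fraction of income as `x` spends at `p`.
  set s : ℕ → ℝ := fun n =>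
    (inner ℝ (q n) (a t ω) / inner ℝ p (a t ω)) * (inner ℝ p x / inner ℝ (q n) x) with hs
  refine ⟨fun n => s n • x, fun n => ⟨fun h => ?_, ?_⟩, ?_⟩
  · exact mul_nonneg (mul_nonneg (div_nonneg (inner_nonneg_of_mem (hqs n) ha) hpa.le)
      (div_nonneg (hpos hp).le (hpos (hqs n)).le)) (hx.1 h)
  · have h1 : inner ℝ (q n) (s n • x)
        = inner ℝ (q n) (a t ω) * (inner ℝ p x / inner ℝ p (a t ω)) := by
      rw [inner_smul_right, hs]
      have := (hpos (hqs n)).ne'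
      field_simp
    rw [h1]
    exact mul_le_of_le_one_right (inner_nonneg_of_mem (hqs n) ha) ((div_le_one hpa).2 hx.2)
  · have h1 : Tendsto s atTop (𝓝 ((inner ℝ p (a t ω) / inner ℝ p (a t ω)) *
        (inner ℝ p x / inner ℝ p x))) :=
      ((hq.inner tendsto_const_nhds).div_const _).mul
        (tendsto_const_nhds.div (hq.inner tendsto_const_nhds) (hpos hp).ne')
    rw [div_self hpa.ne', div_self (hpos hp).ne', one_mul] at h1
    simpa using h1.smul_const x

/-- The preferred sets have a closed graph. -/
lemma mem_preferredSet_of_tendsto [MeasurableSpace T] [MeasurableSpace Ω]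
    {q : ℕ → Commodity ℓ} (hp : p ∈ priceSimplex ℓ)
    (hqs : ∀ n, q n ∈ priceSimplex ℓ) (hq : Tendsto q atTop (𝓝 p))
    (ha : a t ω ∈ consumptionSet ℓ) (hU : AssumptionA2 U) {u : ℕ → Commodity ℓ}
    (hu : ∀ n, u n ∈ preferredSet a U t ω (q n)) (hlim : Tendsto u atTop (𝓝 y)) :
    y ∈ preferredSet a U t ω p := by
  have hy : y ∈ consumptionSet ℓ :=
    isClosed_consumptionSet.mem_of_tendsto hlim (Eventually.of_forall fun n => (hu n).1.1)
  refine ⟨⟨hy, fun x hx => ?_⟩, hy, fun h => ?_⟩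
  · obtain ⟨v, hv, hvx⟩ := exists_seq_mem_budget hp hqs hq ha hx
    exact le_of_tendsto_of_tendsto' (tendsto_utility hU (fun n => (hv n).1) hx.1 hvx)
      (tendsto_utility hU (fun n => (hu n).1.1) hy hlim) fun n => (hu n).1.2 _ (hv n)
  · exact le_of_tendsto_of_tendsto'
      (((EuclideanSpace.proj (𝕜 := ℝ) h).continuous.tendsto y).comp hlim)
      (tendsto_gammaBound hp hq) fun n => (hu n).2.2 h

lemma mem_preferredSet_of_mapClusterPt [MeasurableSpace T] [MeasurableSpace Ω]
    {q : ℕ → Commodity ℓ} (hp : p ∈ priceSimplex ℓ)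
    (hqs : ∀ n, q n ∈ priceSimplex ℓ) (hq : Tendsto q atTop (𝓝 p))
    (ha : a t ω ∈ consumptionSet ℓ) (hU : AssumptionA2 U) {u : ℕ → Commodity ℓ}
    (hu : ∀ n, u n ∈ preferredSet a U t ω (q n)) (hy : MapClusterPt y atTop u) :
    y ∈ preferredSet a U t ω p := by
  obtain ⟨φ, hφ, hlim⟩ := hy.tendsto_subseq
  exact mem_preferredSet_of_tendsto hp (fun n => hqs _) (hq.comp hφ.tendsto_atTop) ha hU
    (fun n => hu _) hlim

/-- A bundle strictly better than the whole budget set stays at least as good under small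
perturbations of the bundle and the price. -/
lemma eventually_mem_atLeastAsGood [MeasurableSpace T] [MeasurableSpace Ω]
    {q : ℕ → Commodity ℓ} (hp : p ∈ priceSimplex ℓ)
    (hqs : ∀ n, q n ∈ priceSimplex ℓ) (hq : Tendsto q atTop (𝓝 p))
    (ha : a t ω ∈ consumptionSet ℓ) (hU : AssumptionA2 U) {u : ℕ → Commodity ℓ}
    (hu : ∀ n, u n ∈ consumptionSet ℓ) (hlim : Tendsto u atTop (𝓝 y))
    (hbest : ∀ x ∈ budget a t ω p, U t ω x < U t ω y) :
    ∀ᶠ n in atTop, u n ∈ atLeastAsGood a U t ω (q n) := by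
  -- Otherwise affordable bundles beat `u` along a subsequence; they are bounded, and a limit of
  -- them is affordable at `p` and at least as good as `y`.
  by_contra hcon
  obtain ⟨φ, hφ, hbad⟩ := extraction_of_frequently_atTop (not_eventually.1 hcon)
  have hbad' : ∀ n, ∃ x ∈ budget a t ω (q (φ n)), U t ω (u (φ n)) < U t ω x := by
    intro n
    by_contra! h
    exact hbad n ⟨hu _, h⟩
  choose v hv hvU using hbad'
  have hγ := (tendsto_gammaBound (a := a) (t := t) (ω := ω) hp hq).bddAbove_range
  obtain ⟨c, hc⟩ := hγ
  have hvc : ∀ n, v n ∈ Metric.closedBall (0 : Commodity ℓ) (c * ‖uniformBundle ℓ 1‖) := by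
    intro n
    have hγc : gammaBound a t ω (q (φ n)) ≤ c := hc ⟨_, rfl⟩
    rw [mem_closedBall_zero_iff]
    exact norm_le_mul_of_mem_consumptionSet ((gammaBound_nonneg (hqs _) ha).trans hγc)
      (hv n).1 fun h => ((budget_subset_truncation (hqs _) ha (hv n)).2 h).trans hγc
  obtain ⟨x, -, ψ, hψ, hx⟩ := (isCompact_closedBall _ _).tendsto_subseq hvc
  have hφψ : Tendsto (φ ∘ ψ) atTop atTop := (hφ.comp hψ).tendsto_atTop
  have hxc : x ∈ consumptionSet ℓ :=
    isClosed_consumptionSet.mem_of_tendsto hx (Eventually.of_forall fun n => (hv _).1)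
  have hyc : y ∈ consumptionSet ℓ :=
    isClosed_consumptionSet.mem_of_tendsto hlim (Eventually.of_forall hu)
  have hxb : x ∈ budget a t ω p :=
    ⟨hxc, le_of_tendsto_of_tendsto' ((hq.comp hφψ).inner hx)
      ((hq.comp hφψ).inner tendsto_const_nhds) fun n => (hv (ψ n)).2⟩
  refine absurd (hbest x hxb) (not_lt.2 ?_)
  exact le_of_tendsto_of_tendsto'
    (tendsto_utility hU (fun n => hu _) hyc (hlim.comp hφψ))
    (tendsto_utility hU (fun n => (hv (ψ n)).1) hxc hx) fun n => (hvU (ψ n)).le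

/-- With at least two commodities the bundle `(γ, …, γ)` is not affordable. -/
lemma ne_uniformBundle_of_mem_budget (hℓ : ℓ ≠ 1) (hp : p ∈ priceSimplex ℓ)
    (ha : a t ω ∈ consumptionSet ℓ) (ha0 : a t ω ≠ 0) (hx : x ∈ budget a t ω p) :
    x ≠ uniformBundle ℓ (gammaBound a t ω p) := by
  rintro rfl
  have hne := nonempty_of_mem_priceSimplex hp
  -- At normalized prices the bundle costs exactly `γ`; affordability forces `1 ≤ minPrice p`, hence
  -- `ℓ ≤ 1`.
  have h1 : gammaBound a t ω p ≤ ∑ h, a t ω h := by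
    have h2 := hx.2.trans (inner_le_sum hp ha)
    rw [inner_eq_sum] at h2
    simpa [← Finset.sum_mul, hp.2] using h2
  have hS : 0 < ∑ h, a t ω h := by
    refine (inner_le_sum hp ha).trans_lt' ?_
    exact not_le.1 fun h => ha0 (eq_zero_of_inner_nonpos hp ha h)
  rw [gammaBound, one_div, inv_mul_eq_div, div_le_iff₀ (minPrice_pos hp)] at h1
  have h3 : 1 ≤ minPrice p := le_of_mul_le_mul_left (by linarith) hS
  have h4 : (ℓ : ℝ) ≤ 1 := by
    rw [← hp.2]
    have := Finset.card_nsmul_le_sum Finset.univ (fun h => p h) 1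
      fun h _ => h3.trans (minPrice_le p h)
    simpa using this
  have h5 : ℓ ≤ 1 := by exact_mod_cast h4
  have h6 : ℓ ≠ 0 := by
    rintro rfl
    exact hne.elim fun i => i.elim0
  omega

/-- The approximation of a preferred bundle `y` at the price `p` by bundles at the price `q`:
move towards `(γ, …, γ)` by the fraction `1 / (k + 1)`, then rescale. -/
noncomputable def approxBundle (a : T → Ω → Commodity ℓ) (t : T) (ω : Ω) (p y q : Commodity ℓ)
    (k : ℕ) : Commodity ℓ :=
  (minPrice p / minPrice q) •
    (y + (1 / ((k : ℝ) + 1)) • (uniformBundle ℓ (gammaBound a t ω p) - y))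

/-- For `k = 0` the move reaches the top of the truncation, which is always preferred. It is the
fallback when `k` is chosen later. -/
lemma approxBundle_zero {q : Commodity ℓ} (hp : p ∈ priceSimplex ℓ) :
    approxBundle a t ω p y q 0 = uniformBundle ℓ (gammaBound a t ω q) := by
  have := (minPrice_pos hp).ne'
  ext h
  simp only [approxBundle, PiLp.smul_apply, PiLp.add_apply, PiLp.sub_apply, uniformBundle_apply,
    gammaBound, smul_eq_mul, Nat.cast_zero]
  field_simp
  ring

lemma one_div_nat_add_one_mem_Icc (k : ℕ) : 1 / ((k : ℝ) + 1) ∈ Icc (0 : ℝ) 1 := by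
  refine ⟨by positivity, ?_⟩
  rw [div_le_one (by positivity)]
  linarith [Nat.cast_nonneg (α := ℝ) k]

/-- As `γ` is inversely proportional to `minPrice`, the rescaling carries the truncation at `p` onto
that at `q`. -/
lemma approxBundle_mem_truncation {q : Commodity ℓ} (hp : p ∈ priceSimplex ℓ)
    (hq : q ∈ priceSimplex ℓ) (hy : y ∈ truncation a t ω p) (k : ℕ) :
    approxBundle a t ω p y q k ∈ truncation a t ω q := by
  have hδp := minPrice_pos hp
  have hδq := minPrice_pos hq
  have hk := one_div_nat_add_one_mem_Icc k
  have hr : 0 ≤ minPrice p / minPrice q := by positivity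
  have hγ : gammaBound a t ω q = minPrice p / minPrice q * gammaBound a t ω p := by
    rw [gammaBound, gammaBound]
    field_simp
  refine ⟨fun h => mul_nonneg hr ?_, fun h => ?_⟩
  · exact add_nonneg (hy.1 h) (mul_nonneg hk.1 (sub_nonneg.2 (hy.2 h)))
  · rw [hγ]
    refine mul_le_mul_of_nonneg_left ?_ hr
    change y h + (1 / ((k : ℝ) + 1)) * (gammaBound a t ω p - y h) ≤ _
    nlinarith [hy.2 h, hk.2]

lemma tendsto_minPrice_div {q : ℕ → Commodity ℓ} (hp : p ∈ priceSimplex ℓ)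
    (hq : Tendsto q atTop (𝓝 p)) :
    Tendsto (fun n => minPrice p / minPrice (q n)) atTop (𝓝 1) := by
  have := nonempty_of_mem_priceSimplex hp
  have h1 : Tendsto (fun n => minPrice (q n)) atTop (𝓝 (minPrice p)) :=
    (continuous_minPrice.tendsto p).comp hq
  have h2 := (tendsto_const_nhds (x := minPrice p)).div h1 (minPrice_pos hp).ne'
  rwa [div_self (minPrice_pos hp).ne'] at h2

/-- The unscaled push is strictly better than the budget set: below the top it improves on `y`
strictly, and the top itself beats everything affordable. A strict gain absorbs small price changes.
-/
lemma eventually_approxBundle_mem [MeasurableSpace T] [MeasurableSpace Ω] (hℓ : ℓ ≠ 1)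
    {q : ℕ → Commodity ℓ} (hp : p ∈ priceSimplex ℓ)
    (hqs : ∀ n, q n ∈ priceSimplex ℓ) (hq : Tendsto q atTop (𝓝 p))
    (ha : a t ω ∈ consumptionSet ℓ) (hU : AssumptionA2 U) (hU3 : AssumptionA3 U)
    (hy : y ∈ preferredSet a U t ω p) (k : ℕ) :
    ∀ᶠ n in atTop, approxBundle a t ω p y (q n) k ∈ preferredSet a U t ω (q n) := by
  have htr := fun n => approxBundle_mem_truncation hp (hqs n) hy.2 k
  suffices h : ∀ᶠ n in atTop, approxBundle a t ω p y (q n) k ∈ atLeastAsGood a U t ω (q n) from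
    h.mono fun n hn => ⟨hn, htr n⟩
  -- With zero endowment no strict gain is needed: only the bundle `0` is affordable.
  rcases eq_or_ne (a t ω) 0 with ha0 | ha0
  · refine Eventually.of_forall fun n => ⟨(htr n).1, fun x hx => ?_⟩
    have hx0 : x = 0 := eq_zero_of_inner_nonpos (hqs n) hx.1 (by simpa [ha0] using hx.2)
    refine hU3.monotone hx.1 fun h => ?_
    rw [hx0]
    exact (htr n).1 h
  set s : ℝ := 1 / ((k : ℝ) + 1) with hs
  have hs0 : 0 < s := by positivity
  set y' := y + s • (uniformBundle ℓ (gammaBound a t ω p) - y) with hy'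
  have hlim : Tendsto (fun n => approxBundle a t ω p y (q n) k) atTop (𝓝 y') := by
    have h1 := (tendsto_minPrice_div hp hq).smul_const y'
    rwa [one_smul] at h1
  refine eventually_mem_atLeastAsGood hp hqs hq ha hU (fun n => (htr n).1) hlim fun x hx => ?_
  rcases eq_or_ne y (uniformBundle ℓ (gammaBound a t ω p)) with hyγ | hyγ
  · have : y' = uniformBundle ℓ (gammaBound a t ω p) := by simp [hy', ← hyγ]
    rw [this]
    exact hU3.lt_of_le_of_ne hx.1 (budget_subset_truncation hp ha hx).2
      (ne_uniformBundle_of_mem_budget hℓ hp ha ha0 hx)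
  · refine (hy.1.2 x hx).trans_lt (hU3 t ω y hy.1.1 _ (fun h => ?_) ?_)
    · exact mul_nonneg hs0.le (sub_nonneg.2 (hy.2.2 h))
    · exact smul_ne_zero hs0.ne' (sub_ne_zero.2 hyγ.symm)

end Economy

/-! ### Measurability of the preferred sets. -/

section Measurability

variable {T Ω : Type*} [MeasurableSpace T] [MeasurableSpace Ω] {ℓ : ℕ}
  {a : T → Ω → Commodity ℓ} {U : T → Ω → Commodity ℓ → ℝ} {ω : Ω} {p : Commodity ℓ}

lemma measurable_utility_posPart (hU : AssumptionA2 U) (ω : Ω) {y : T → Commodity ℓ}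
    (hy : Measurable y) : Measurable fun t => U t ω (posPart (y t)) := by
  have h : Measurable (Function.uncurry fun (x : Commodity ℓ) (t : T) => U t ω (posPart x)) :=
    measurable_uncurry_of_continuous_of_measurable
      (fun t => continuous_utility_posPart hU t ω)
      fun x => (hU.1 _ (posPart_mem x)).comp measurable_prodMk_right
  exact h.comp (hy.prodMk measurable_id)

/-- Membership in `C(t, ω, p)` needs to be tested on countably many bundles only. -/
lemma exists_countable_forall_budget (hp : p ∈ priceSimplex ℓ) (hU : AssumptionA2 U) :
    ∃ D : Set (Commodity ℓ), D.Countable ∧ ∀ t ω, a t ω ∈ consumptionSet ℓ → ∀ c : ℝ,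
      (∀ x ∈ budget a t ω p, U t ω x ≤ c) ↔
        ∀ d ∈ D, U t ω (posPart (inner ℝ p (a t ω) • d)) ≤ c := by
  -- Budget sets are multiples of the one with income `1`, so one countable dense set serves every
  -- agent and state.
  obtain ⟨D, hD1, hDc, hD2⟩ := (TopologicalSpace.IsSeparable.of_separableSpace
    {x | x ∈ consumptionSet ℓ ∧ inner ℝ p x ≤ 1}).exists_countable_dense_subset
  refine ⟨D, hDc, fun t ω ha c => ⟨fun h d hd => h _ ⟨posPart_mem _, ?_⟩, fun h x hx => ?_⟩⟩
  · have hw := inner_nonneg_of_mem hp ha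
    rw [posPart_eq_self fun i => mul_nonneg hw ((hD1 hd).1 i), inner_smul_right]
    exact mul_le_of_le_one_right hw (hD1 hd).2
  · have hw := inner_nonneg_of_mem hp ha
    set w := inner ℝ p (a t ω)
    have hcl : IsClosed {d : Commodity ℓ | U t ω (posPart (w • d)) ≤ c} :=
      isClosed_le ((continuous_utility_posPart hU t ω).comp (continuous_const_smul w))
        continuous_const
    have hmem : w⁻¹ • x ∈ closure D := by
      refine hD2 ⟨fun i => mul_nonneg (inv_nonneg.2 hw) (hx.1 i), ?_⟩
      rw [inner_smul_right]
      exact (mul_le_mul_of_nonneg_left hx.2 (inv_nonneg.2 hw)).trans (inv_mul_le_one (a := w))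
    have h1 : U t ω (posPart (w • w⁻¹ • x)) ≤ c := closure_minimal h hcl hmem
    -- For `w = 0` the inverse is `0` by convention, and the identity holds because `x = 0`.
    have h2 : w • w⁻¹ • x = x := by
      rcases eq_or_ne w 0 with hw0 | hw0
      · have hx0 : x = 0 := eq_zero_of_inner_nonpos hp hx.1 (hx.2.trans hw0.le)
        simp [hx0]
      · exact smul_inv_smul₀ hw0 x
    rwa [h2, posPart_eq_self hx.1] at h1

lemma measurable_endowment {μ : Measure T} (hA1 : AssumptionA1 μ a) (ω : Ω) :
    Measurable fun t => a t ω :=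
  hA1.2.1.comp measurable_prodMk_right

lemma measurable_gammaBound {μ : Measure T} (hA1 : AssumptionA1 μ a) (ω : Ω) (p : Commodity ℓ) :
    Measurable fun t => gammaBound a t ω p :=
  (Finset.measurable_sum _ fun h _ => (EuclideanSpace.proj (𝕜 := ℝ) h).measurable.comp
    (measurable_endowment hA1 ω)).const_mul _

lemma measurable_uniformBundle {c : T → ℝ} (hc : Measurable c) :
    Measurable fun t => uniformBundle ℓ (c t) := by
  simp_rw [uniformBundle_eq_smul (ℓ := ℓ) (c _)]
  exact hc.smul_const _

lemma measurableSet_mem_preferredSet {μ : Measure T} (hA1 : AssumptionA1 μ a)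
    (hU : AssumptionA2 U) (hp : p ∈ priceSimplex ℓ) {y : T → Commodity ℓ} (hy : Measurable y) :
    MeasurableSet {t | y t ∈ preferredSet a U t ω p} := by
  obtain ⟨D, hDc, hD⟩ := exists_countable_forall_budget (a := a) hp hU
  have hset : {t | y t ∈ preferredSet a U t ω p} =
      ((y ⁻¹' consumptionSet ℓ) ∩ ⋂ d ∈ D, {t | U t ω (posPart (inner ℝ p (a t ω) • d))
        ≤ U t ω (posPart (y t))}) ∩ ⋂ h, {t | y t h ≤ gammaBound a t ω p} := by
    ext t
    simp only [preferredSet, atLeastAsGood, truncation, mem_inter_iff, mem_ofPred_eq,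
      mem_preimage, mem_iInter]
    constructor
    · rintro ⟨⟨h1, h2⟩, -, h3⟩
      exact ⟨⟨h1, by rw [posPart_eq_self h1]; exact (hD t ω (hA1.1 t ω) _).1 h2⟩, h3⟩
    · rintro ⟨⟨h1, h2⟩, h3⟩
      rw [posPart_eq_self h1] at h2
      exact ⟨⟨h1, (hD t ω (hA1.1 t ω) _).2 h2⟩, h1, h3⟩
  rw [hset]
  refine ((hy isClosed_consumptionSet.measurableSet).inter
    (MeasurableSet.biInter hDc fun d _ => ?_)).inter (MeasurableSet.iInter fun h => ?_)
  · exact measurableSet_le (measurable_utility_posPart hU ω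
      ((measurable_const.inner (measurable_endowment hA1 ω)).smul_const d))
      (measurable_utility_posPart hU ω hy)
  · exact measurableSet_le ((EuclideanSpace.proj (𝕜 := ℝ) h).measurable.comp hy)
      (measurable_gammaBound hA1 ω p)

end Measurability

lemma aggregatePreferred_subset {T Ω : Type*} [MeasurableSpace T] {ℓ : ℕ} {μ : Measure T}
    {a : T → Ω → Commodity ℓ} {U : T → Ω → Commodity ℓ → ℝ} {ω : Ω} {p : Commodity ℓ} :
    aggregatePreferred μ a U ω p ⊆ consumptionSet ℓ := by
  rintro _ ⟨f, hf, hfp, rfl⟩ h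
  have h1 := (EuclideanSpace.proj (𝕜 := ℝ) h).integral_comp_comm hf
  change ∫ t, f t h ∂μ = (∫ t, f t ∂μ) h at h1
  rw [← h1]
  exact integral_nonneg_of_ae (hfp.mono fun t ht => ht.1.1 h)

/-! ### The aggregate preferred set. -/

section Aggregate

variable {T Ω : Type*} [MeasurableSpace T] [MeasurableSpace Ω] {ℓ : ℕ} {μ : Measure T}
  {a : T → Ω → Commodity ℓ} {U : T → Ω → Commodity ℓ → ℝ} {ω : Ω} {p : Commodity ℓ}

lemma integrable_sum_endowment (hA1 : AssumptionA1 μ a) (ω : Ω) :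
    Integrable (fun t => ∑ h, a t ω h) μ :=
  integrable_finsetSum _ fun h _ =>
    (EuclideanSpace.proj (𝕜 := ℝ) h).integrable_comp (hA1.2.2 ω).1

/-- A common integrable bound for the preferred sets along a convergent sequence of prices. -/
lemma exists_integrable_bound (hA1 : AssumptionA1 μ a) (ω : Ω) {q : ℕ → Commodity ℓ}
    (hp : p ∈ priceSimplex ℓ) (hqs : ∀ n, q n ∈ priceSimplex ℓ) (hq : Tendsto q atTop (𝓝 p)) :
    ∃ g : T → ℝ, Integrable g μ ∧ ∀ n t, ∀ y ∈ truncation a t ω (q n), ‖y‖ ≤ g t := by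
  have := nonempty_of_mem_priceSimplex hp
  have h1 : Tendsto (fun n => 1 / minPrice (q n)) atTop (𝓝 (1 / minPrice p)) :=
    tendsto_const_nhds.div ((continuous_minPrice.tendsto p).comp hq) (minPrice_pos hp).ne'
  obtain ⟨c, hc⟩ := h1.bddAbove_range
  refine ⟨fun t => c * (∑ h, a t ω h) * ‖uniformBundle ℓ 1‖,
    ((integrable_sum_endowment hA1 ω).const_mul c).mul_const _, fun n t y hy => ?_⟩
  have hγ : gammaBound a t ω (q n) ≤ c * ∑ h, a t ω h :=
    mul_le_mul_of_nonneg_right (hc ⟨n, rfl⟩) (sum_endowment_nonneg (hA1.1 t ω))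
  exact norm_le_mul_of_mem_consumptionSet
    ((gammaBound_nonneg (hqs n) (hA1.1 t ω)).trans hγ) hy.1 fun h => (hy.2 h).trans hγ

lemma integrable_of_forall_mem_truncation (hA1 : AssumptionA1 μ a) (hp : p ∈ priceSimplex ℓ)
    {f : T → Commodity ℓ} (hf : Measurable f) (hft : ∀ t, f t ∈ truncation a t ω p) :
    Integrable f μ := by
  obtain ⟨g, hg, hgb⟩ := exists_integrable_bound hA1 ω hp (fun _ : ℕ => hp) tendsto_const_nhds
  exact hg.mono' hf.aestronglyMeasurable (Eventually.of_forall fun t => hgb 0 t _ (hft t))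

lemma aggregatePreferred_nonempty (hA1 : AssumptionA1 μ a) (hU3 : AssumptionA3 U)
    (hp : p ∈ priceSimplex ℓ) : (aggregatePreferred μ a U ω p).Nonempty := by
  have h := fun t => uniformBundle_mem_preferredSet (U := U) hp (hA1.1 t ω) hU3
  exact ⟨_, _, integrable_of_forall_mem_truncation hA1 hp
    (measurable_uniformBundle (measurable_gammaBound hA1 ω p)) (fun t => (h t).2),
    Eventually.of_forall h, rfl⟩

/-- Limits of aggregate preferred bundles along convergent prices are aggregate preferred. -/
lemma mem_aggregatePreferred_of_tendsto [IsFiniteMeasure μ] (hA1 : AssumptionA1 μ a)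
    (hU : AssumptionA2 U) {q : ℕ → Commodity ℓ} (hp : p ∈ priceSimplex ℓ)
    (hqs : ∀ n, q n ∈ priceSimplex ℓ) (hq : Tendsto q atTop (𝓝 p)) {z : ℕ → Commodity ℓ}
    (hz : ∀ n, z n ∈ aggregatePreferred μ a U ω (q n)) {y : Commodity ℓ}
    (hy : Tendsto z atTop (𝓝 y)) : y ∈ aggregatePreferred μ a U ω p := by
  obtain ⟨g, hg, hgb⟩ := exists_integrable_bound hA1 ω hp hqs hq
  choose f hf hfp hfz using hz
  obtain ⟨F, hF, hFc, hFy⟩ := exists_selection_of_tendsto_integral hg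
    (fun n => (hf n).aestronglyMeasurable)
    (fun n => (hfp n).mono fun t ht => hgb n t _ ht.2) (by simpa only [hfz] using hy)
  refine ⟨F, hF, ?_, hFy⟩
  filter_upwards [ae_all_iff.2 hfp, hFc] with t h1 h2
  exact mem_preferredSet_of_mapClusterPt hp hqs hq (hA1.1 t ω) hU h1 h2

lemma exists_subseq_tendsto_aggregatePreferred [IsFiniteMeasure μ] (hA1 : AssumptionA1 μ a)
    (hU : AssumptionA2 U) {q : ℕ → Commodity ℓ} (hp : p ∈ priceSimplex ℓ)
    (hqs : ∀ n, q n ∈ priceSimplex ℓ) (hq : Tendsto q atTop (𝓝 p)) {z : ℕ → Commodity ℓ}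
    (hz : ∀ n, z n ∈ aggregatePreferred μ a U ω (q n)) :
    ∃ y ∈ aggregatePreferred μ a U ω p, ∃ φ : ℕ → ℕ, StrictMono φ ∧
      Tendsto (z ∘ φ) atTop (𝓝 y) := by
  obtain ⟨g, hg, hgb⟩ := exists_integrable_bound hA1 ω hp hqs hq
  have hzb : ∀ n, z n ∈ Metric.closedBall (0 : Commodity ℓ) (∫ t, g t ∂μ) := by
    intro n
    obtain ⟨f, hf, hfp, hfz⟩ := hz n
    rw [mem_closedBall_zero_iff, ← hfz]
    exact norm_integral_le_of_norm_le hg (hfp.mono fun t ht => hgb n t _ ht.2)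
  obtain ⟨y, -, φ, hφ, hy⟩ := (isCompact_closedBall _ _).tendsto_subseq hzb
  exact ⟨y, mem_aggregatePreferred_of_tendsto hA1 hU hp (fun n => hqs _)
    (hq.comp hφ.tendsto_atTop) (fun n => hz _) hy, φ, hφ, hy⟩

/-- An aggregate preferred bundle is the integral of an everywhere defined measurable selection. -/
lemma exists_measurable_selection (hA1 : AssumptionA1 μ a) (hU : AssumptionA2 U)
    (hU3 : AssumptionA3 U) (hp : p ∈ priceSimplex ℓ) {y : Commodity ℓ}
    (hy : y ∈ aggregatePreferred μ a U ω p) :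
    ∃ f : T → Commodity ℓ, Measurable f ∧ (∀ t, f t ∈ preferredSet a U t ω p) ∧
      ∫ t, f t ∂μ = y := by
  classical
  obtain ⟨f, hf, hfp, hfy⟩ := hy
  set f' := hf.aestronglyMeasurable.mk f
  have hf' : Measurable f' := hf.aestronglyMeasurable.stronglyMeasurable_mk.measurable
  have hff' : f =ᵐ[μ] f' := hf.aestronglyMeasurable.ae_eq_mk
  -- The measurable version of `f` may leave the preferred set on a null set, where the top bundle
  -- replaces it.
  set A := {t | f' t ∈ preferredSet a U t ω p} with hA
  have hAm : MeasurableSet A := measurableSet_mem_preferredSet hA1 hU hp hf'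
  refine ⟨A.piecewise f' fun t => uniformBundle ℓ (gammaBound a t ω p),
    hf'.piecewise hAm (measurable_uniformBundle (measurable_gammaBound hA1 ω p)), fun t => ?_, ?_⟩
  · by_cases ht : t ∈ A
    · rw [Set.piecewise_eq_of_mem _ _ _ ht]
      exact ht
    · simpa [ht] using uniformBundle_mem_preferredSet hp (hA1.1 t ω) hU3
  · rw [← hfy]
    refine integral_congr_ae ?_
    filter_upwards [hff', hfp] with t h1 h2
    have ht : t ∈ A := by rw [hA, mem_ofPred_eq, ← h1]; exact h2
    simp [ht, h1]

/-- Aggregate preferred bundles are limits of aggregate preferred bundles at nearby prices. -/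
lemma exists_seq_mem_aggregatePreferred (hℓ : ℓ ≠ 1) (hA1 : AssumptionA1 μ a)
    (hU : AssumptionA2 U) (hU3 : AssumptionA3 U) {q : ℕ → Commodity ℓ} (hp : p ∈ priceSimplex ℓ)
    (hqs : ∀ n, q n ∈ priceSimplex ℓ) (hq : Tendsto q atTop (𝓝 p)) {y : Commodity ℓ}
    (hy : y ∈ aggregatePreferred μ a U ω p) :
    ∃ z : ℕ → Commodity ℓ, (∀ n, z n ∈ aggregatePreferred μ a U ω (q n)) ∧
      Tendsto z atTop (𝓝 y) := by
  classical
  obtain ⟨f, hf, hfp, rfl⟩ := exists_measurable_selection hA1 hU hU3 hp hy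
  set Y : ℕ → ℕ → T → Commodity ℓ := fun n k t => approxBundle a t ω p (f t) (q n) k with hY
  have hYm : ∀ n k, Measurable (Y n k) := fun n k =>
    (hf.add (((measurable_uniformBundle (measurable_gammaBound hA1 ω p)).sub hf).const_smul
      (1 / ((k : ℝ) + 1)))).const_smul (minPrice p / minPrice (q n))
  -- The smallest admissible push with `k ≤ n`. The cap makes `K n` well defined and measurable;
  -- each fixed `k` is eventually admissible, so `K n t → ∞`.
  set K : ℕ → T → ℕ := fun n t =>
    Nat.findGreatest (fun k => Y n k t ∈ preferredSet a U t ω (q n)) n with hK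
  have hKm : ∀ n, Measurable (K n) := fun n =>
    measurable_findGreatest fun k _ => measurableSet_mem_preferredSet hA1 hU (hqs n) (hYm n k)
  have hmem : ∀ n t, Y n (K n t) t ∈ preferredSet a U t ω (q n) := by
    intro n t
    refine Nat.findGreatest_spec (P := fun k => Y n k t ∈ preferredSet a U t ω (q n))
      (Nat.zero_le n) ?_
    simp only [hY, approxBundle_zero hp]
    exact uniformBundle_mem_preferredSet (hqs n) (hA1.1 t ω) hU3
  have hm : ∀ n, Measurable fun t => Y n (K n t) t := fun n =>
    Measurable.apply_index (hYm n) (hKm n)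
  have hKlim : ∀ t, Tendsto (fun n => K n t) atTop atTop := by
    intro t
    refine tendsto_atTop.2 fun k => ?_
    filter_upwards [eventually_approxBundle_mem hℓ hp hqs hq (hA1.1 t ω) hU hU3 (hfp t) k,
      eventually_ge_atTop k] with n h1 h2
    exact Nat.le_findGreatest h2 h1
  have hlim : ∀ t, Tendsto (fun n => Y n (K n t) t) atTop (𝓝 (f t)) := by
    intro t
    have h1 := (tendsto_one_div_add_atTop_nhds_zero_nat (𝕜 := ℝ)).comp (hKlim t)
    have h2 := (tendsto_minPrice_div hp hq).smul ((h1.smul_const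
      (uniformBundle ℓ (gammaBound a t ω p) - f t)).const_add (f t))
    rwa [zero_smul, add_zero, one_smul] at h2
  obtain ⟨g, hg, hgb⟩ := exists_integrable_bound hA1 ω hp hqs hq
  refine ⟨fun n => ∫ t, Y n (K n t) t ∂μ, fun n => ⟨_, ?_, Eventually.of_forall (hmem n), rfl⟩, ?_⟩
  · exact integrable_of_forall_mem_truncation hA1 (hqs n) (hm n) fun t => (hmem n t).2
  · exact tendsto_integral_of_dominated_convergence g (fun n => (hm n).aestronglyMeasurable) hg
      (fun n => Eventually.of_forall fun t => hgb n t _ (hmem n t).2) (Eventually.of_forall hlim)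

end Aggregate

lemma subsingleton_priceSimplex_one : (priceSimplex 1).Subsingleton := by
  rintro p hp q hq
  ext h
  rw [Subsingleton.elim h 0]
  have h1 := hp.2
  have h2 := hq.2
  simp only [Finset.univ_unique, Fin.default_eq_zero, Finset.sum_singleton] at h1 h2
  rw [h1, h2]

end DiffInfoEconomy

theorem mainTheorem2 {T Ω : Type*} [MeasurableSpace T] [MeasurableSpace Ω] {ℓ : ℕ}
    (μ : MeasureTheory.Measure T) [MeasureTheory.IsFiniteMeasure μ]
    (a : T → Ω → DiffInfoEconomy.Commodity ℓ)
    (U : T → Ω → DiffInfoEconomy.Commodity ℓ → ℝ)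
    (hA1 : DiffInfoEconomy.AssumptionA1 μ a)
    (hA2 : DiffInfoEconomy.AssumptionA2 U)
    (hA3 : DiffInfoEconomy.AssumptionA3 U)
    (ω : Ω) :
    (∀ p ∈ DiffInfoEconomy.priceSimplex ℓ,
      DiffInfoEconomy.aggregatePreferred μ a U ω p ⊆ DiffInfoEconomy.consumptionSet ℓ) ∧
    DiffInfoEconomy.HausdorffContinuous
      (fun p : DiffInfoEconomy.priceSimplex ℓ =>
        DiffInfoEconomy.aggregatePreferred μ a U ω (p : DiffInfoEconomy.Commodity ℓ)) := by
  refine ⟨fun p _ => DiffInfoEconomy.aggregatePreferred_subset,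
    DiffInfoEconomy.hausdorffContinuous_of_seq
      (fun p => DiffInfoEconomy.aggregatePreferred_nonempty hA1 hA3 p.2)
      (fun q p hq z hz => DiffInfoEconomy.exists_subseq_tendsto_aggregatePreferred hA1 hA2 p.2
        (fun n => (q n).2) ((continuous_subtype_val.tendsto p).comp hq) hz)
      (fun q p hq y hy => ?_)⟩
  -- For `ℓ = 1` the top bundle is the endowment itself, so no strict gain is available; but there
  -- is only one price and a constant sequence suffices.
  rcases eq_or_ne ℓ 1 with rfl | hℓ
  · refine ⟨fun _ => y, fun n => ?_, tendsto_const_nhds⟩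
    have h : q n = p := Subtype.ext
      (DiffInfoEconomy.subsingleton_priceSimplex_one (q n).2 p.2)
    rw [h]
    exact hy
  · exact DiffInfoEconomy.exists_seq_mem_aggregatePreferred hℓ hA1 hA2 hA3 p.2
      (fun n => (q n).2) ((continuous_subtype_val.tendsto p).comp hq) hy
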